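/- Let $\kappa>0$. A (rooted) loop $\gamma$ in $\mathbb Z^2$ is a nearest-neighbour closed walk $x_0,x_1,\dots,x_t=x_0$ with $t=t_\gamma\ge 1$ steps; put \[ \tilde\mu^{\kappa}(\gamma)=\frac1{t_\gamma}(4+\kappa)^{-t_\gamma}. \] Let $\tilde{\mathcal L}$ be the infinite-volume massive random walk loop soup with intensity $\lambda=\tfrac12$, i.e. the Poisson point process on the set of all loops in $\mathbb Z^2$ with intensity measure $\tfrac12\tilde\mu^\kappa$, and let $\langle\cdot\rangle^\kappa_{\mathbb Z^2}$ be the expectation with respect to it. For a face $z$ of $\mathbb Z^2$ (a vertex of the dual lattice $(\mathbb Z^2)^*$, placed at the centre of the face) let $N_\gamma(z)$ be the winding number of the linearly interpolated loop $\gamma$ around $z$, and define the massive spin field \[ \sigma^\kappa(z)=e^{i\pi\tilde N(z)}\in\{-1,1\},\qquad \tilde N(z)=\sum_{\gamma\in\tilde{\mathcal L}}N_\gamma(z). \] Then almost surely, for every face $z$, only finitely many loops of the soup have non-zero winding number around $z$, so that the random field $\sigma^\kappa$ is well defined, and it is reflection positive in the following sense. Let $l$ be any line through dual vertices such that the reflection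 $\vartheta$ in $l$ preserves $\mathbb Z^2$ (so $l$ is horizontal, vertical or diagonal), and let $(\mathbb Z^2_+)^*$ be the set of dual vertices in one of the two closed half-planes bounded by $l$ (dual vertices on $l$ belong to it). Let $\mathcal F^+$ be the set of measurable real-valued functions of the spins $(\sigma(z))_{z\in(\mathbb Z^2_+)^*}$, and for $f\in\mathcal F^+$ put $\vartheta f(\sigma)=f(\sigma\circ\vartheta)$. Then for all $f,g\in\mathcal F^+$, \[ \langle f\,\vartheta g\rangle^{\kappa}_{\mathbb Z^2}=\langle g\,\vartheta f\rangle^{\kappa}_{\mathbb Z^2} \] whenever $f\,\vartheta g$ is integrable (then so is $g\,\vartheta f$), and \[ \langle f\,\vartheta f\rangle^{\kappa}_{\mathbb Z^2}\ge 0 \] whenever $f\,\vartheta f$ is integrable; in particular both hold for all bounded $f,g\in\mathcal F^+$. -/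

import Mathlib

open scoped NNReal
open MeasureTheory ProbabilityTheory

namespace LoopSoup

noncomputable section

/-- The square lattice `ℤ²` with its nearest-neighbour edges. -/
def squareLattice : SimpleGraph (ℤ × ℤ) where
  Adj v w := |v.1 - w.1| + |v.2 - w.2| = 1
  symm := ⟨fun v w h => by simpa only [abs_sub_comm] using h⟩
  loopless := ⟨fun v h => by simp at h⟩

/-- Faces of `ℤ²`, i.e. vertices of the dual lattice. The face `(i, j)` is the open unit square
with lower left corner `(i, j)`. -/
abbrev Face : Type := ℤ × ℤ

/-- The vertex `(i, j)` as the point `i + j √-1` of the complex plane. -/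
def vertexPoint (v : ℤ × ℤ) : ℂ := ⟨(v.1 : ℝ), (v.2 : ℝ)⟩

/-- The position of the dual vertex of a face: the centre of the unit square. -/
def faceCenter (z : Face) : ℂ := ⟨(z.1 : ℝ) + 1 / 2, (z.2 : ℝ) + 1 / 2⟩

/-- The face containing a point of the plane. -/
def faceAt (w : ℂ) : Face := (⌊w.re⌋, ⌊w.im⌋)

/-- Rooted (oriented) nearest-neighbour loops in `ℤ²` with at least one step: closed walks
`x₀, x₁, …, x_t = x₀` with `t ≥ 1`. -/
abbrev Loop : Type := (v : ℤ × ℤ) × {p : squareLattice.Walk v v // 0 < p.length}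

/-- The number of steps `t_γ` of a loop. -/
def Loop.time (γ : Loop) : ℕ := γ.2.1.length

/-- The change of the argument of `w - c` as `w` runs along the segment from the lattice point
`x` to the neighbouring lattice point `y`, where `c` is the centre of the face `z`. The segment
is a lattice edge, so it misses `c` and is seen from `c` under an angle at most `π / 2`; hence the
change is the principal argument of the quotient. -/
def stepAngle (z : Face) (x y : ℤ × ℤ) : ℝ :=
  Complex.arg ((vertexPoint y - faceCenter z) / (vertexPoint x - faceCenter z))

/-- The total change of the argument around the centre of `z` along a walk. -/
def totalAngle (z : Face) {x y : ℤ × ℤ} (p : squareLattice.Walk x y) : ℝ :=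
  (p.darts.map fun d => stepAngle z d.fst d.snd).sum

/-- The winding number `N_γ(z)` of the (linearly interpolated) loop `γ` around the centre of the
face `z`: the total change of the argument divided by `2π`. The quotient is an integer, see
`windingNumber_mul_two_pi`, so the rounding changes nothing. -/
def windingNumber (γ : Loop) (z : Face) : ℤ :=
  round (totalAngle z γ.2.1 / (2 * Real.pi))

theorem vertexPoint_sub_faceCenter_ne_zero (x : ℤ × ℤ) (z : Face) :
    vertexPoint x - faceCenter z ≠ 0 := by
  intro h
  have h1 := congrArg Complex.re h
  simp only [vertexPoint, faceCenter, Complex.sub_re, Complex.zero_re] at h1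
  have h2 : (2 * x.1 : ℝ) = 2 * z.1 + 1 := by linarith
  have h3 : 2 * x.1 = 2 * z.1 + 1 := by exact_mod_cast h2
  omega

theorem exp_totalAngle (z : Face) {x y : ℤ × ℤ} (p : squareLattice.Walk x y) :
    (‖vertexPoint y - faceCenter z‖ : ℂ) * (vertexPoint x - faceCenter z)
        * Complex.exp (totalAngle z p * Complex.I)
      = ‖vertexPoint x - faceCenter z‖ * (vertexPoint y - faceCenter z) := by
  induction p with
  | nil => simp [totalAngle]
  | @cons u v w h p ih =>
    have hu := vertexPoint_sub_faceCenter_ne_zero u z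
    have hv := vertexPoint_sub_faceCenter_ne_zero v z
    have hv' : (‖vertexPoint v - faceCenter z‖ : ℂ) ≠ 0 := by simpa using hv
    have hu' : (‖vertexPoint u - faceCenter z‖ : ℂ) ≠ 0 := by simpa using hu
    have hs : totalAngle z (SimpleGraph.Walk.cons h p) = stepAngle z u v + totalAngle z p := by
      simp [totalAngle]
    have hq := Complex.norm_mul_exp_arg_mul_I
      ((vertexPoint v - faceCenter z) / (vertexPoint u - faceCenter z))
    rw [norm_div, Complex.ofReal_div] at hq
    have hq' : (‖vertexPoint v - faceCenter z‖ : ℂ) * (vertexPoint u - faceCenter z)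
        * Complex.exp (stepAngle z u v * Complex.I)
        = ‖vertexPoint u - faceCenter z‖ * (vertexPoint v - faceCenter z) := by
      unfold stepAngle
      field_simp at hq
      linear_combination hq
    rw [hs, Complex.ofReal_add, add_mul, Complex.exp_add]
    apply mul_left_cancel₀ (mul_ne_zero hv' hv)
    linear_combination
      (‖vertexPoint w - faceCenter z‖ : ℂ) * (vertexPoint v - faceCenter z)
        * Complex.exp (totalAngle z p * Complex.I) * hq'
      + (‖vertexPoint u - faceCenter z‖ : ℂ) * (vertexPoint v - faceCenter z) * ih

/-- The total change of the argument along a loop is `2π` times its winding number. -/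
theorem windingNumber_mul_two_pi (γ : Loop) (z : Face) :
    (windingNumber γ z : ℝ) * (2 * Real.pi) = totalAngle z γ.2.1 := by
  have h := exp_totalAngle z γ.2.1
  have h0 := vertexPoint_sub_faceCenter_ne_zero γ.1 z
  have h1 : (‖vertexPoint γ.1 - faceCenter z‖ : ℂ) ≠ 0 := by simpa using h0
  have h2 : Complex.exp (totalAngle z γ.2.1 * Complex.I) = 1 := by
    apply mul_left_cancel₀ (mul_ne_zero h1 h0)
    rw [h, mul_one]
  obtain ⟨n, hn⟩ := Complex.exp_eq_one_iff.1 h2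
  have h3 : (totalAngle z γ.2.1 : ℂ) = ((n * (2 * Real.pi) : ℝ) : ℂ) := by
    apply mul_right_cancel₀ Complex.I_ne_zero
    rw [hn]; push_cast; ring
  have h4 : totalAngle z γ.2.1 = n * (2 * Real.pi) := by exact_mod_cast h3
  have hpi : (2 * Real.pi) ≠ 0 := by positivity
  rw [windingNumber, h4, mul_div_cancel_right₀ _ hpi, round_intCast]

/-- The massive loop measure: `μ^κ(γ) = (4 + κ)^(-t_γ) / t_γ`. -/
def massiveLoopMass (κ : ℝ≥0) (γ : Loop) : ℝ≥0 :=
  1 / (γ.time : ℝ≥0) * (1 / (4 + κ) ^ γ.time)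

/-- A realization of a loop soup: the multiplicity of every loop in the collection. -/
abbrev SoupConfig : Type := Loop → ℕ

/-- The law of the infinite-volume massive random walk loop soup, the Poisson point process on the
countable set of loops with intensity measure `lam • μ^κ`: the multiplicities of the loops are
independent Poisson variables, that of `γ` with mean `lam * μ^κ(γ)`. -/
def loopSoup (κ lam : ℝ≥0) : Measure SoupConfig :=
  Measure.infinitePi fun γ : Loop => poissonMeasure (lam * massiveLoopMass κ γ)

/-- The total winding `N(z) = ∑_γ N_γ(z)` around the face `z` of all loops in the soup, counted
with multiplicity. -/
def totalWinding (ω : SoupConfig) (z : Face) : ℤ :=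
  ∑ᶠ γ : Loop, (ω γ : ℤ) * windingNumber γ z

/-- The spin field `σ(z) = exp(iπ N(z)) = (-1)^N(z)`, with values in `{1, -1}`. -/
def spinField (ω : SoupConfig) (z : Face) : ℤˣ := (totalWinding ω z).negOnePow

theorem spinField_eq_exp (ω : SoupConfig) (z : Face) :
    ((spinField ω z : ℤ) : ℂ) = Complex.exp (Complex.I * Real.pi * totalWinding ω z) := by
  rw [mul_comm, mul_comm Complex.I, Complex.exp_int_mul, Complex.exp_pi_mul_I, spinField,
    Int.cast_negOnePow]

/-- The reflection of the plane in the line through `c` with unit normal vector `u`. -/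
def reflectPoint (c u w : ℂ) : ℂ := w - ((2 * inner ℝ u (w - c) : ℝ) : ℂ) * u

/-- The faces whose centres lie in the closed half-plane into which the normal `u` of the line
through `c` points. The faces with centre on the line belong to it. -/
def halfFaces (c u : ℂ) : Set Face := {z | 0 ≤ inner ℝ u (faceCenter z - c)}

/-- The map induced on faces by the reflection in the line through `c` with unit normal `u`. -/
def reflectFace (c u : ℂ) (z : Face) : Face := faceAt (reflectPoint c u (faceCenter z))

/-- The restriction `(s z)_{z ∈ H}` of a spin configuration. -/
def restrictSpins (H : Set Face) (s : Face → ℤˣ) : H → ℤˣ := fun z => s z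

/-- Reflection positivity of a random spin field `σ` on a probability space `(Ω, P)`, with respect
to an involution `θ` of the faces and a half `H` of the faces. A function `f` of the spins
in `H` is evaluated on `σ`, and `ϑ f` is `f` evaluated on `σ ∘ θ`. All measurable
functions are admitted for which the expectations exist. -/
def IsReflectionPositive {Ω : Type*} [MeasurableSpace Ω] (P : Measure Ω) (σ : Ω → Face → ℤˣ)
    (H : Set Face) (θ : Face → Face) : Prop :=
  (∀ f g : (H → ℤˣ) → ℝ, Measurable f → Measurable g →
    Integrable (fun ω => f (restrictSpins H (σ ω)) * g (restrictSpins H (σ ω ∘ θ))) P →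
    Integrable (fun ω => g (restrictSpins H (σ ω)) * f (restrictSpins H (σ ω ∘ θ))) P ∧
    ∫ ω, f (restrictSpins H (σ ω)) * g (restrictSpins H (σ ω ∘ θ)) ∂P
      = ∫ ω, g (restrictSpins H (σ ω)) * f (restrictSpins H (σ ω ∘ θ)) ∂P) ∧
  (∀ f : (H → ℤˣ) → ℝ, Measurable f →
    Integrable (fun ω => f (restrictSpins H (σ ω)) * f (restrictSpins H (σ ω ∘ θ))) P →
    0 ≤ ∫ ω, f (restrictSpins H (σ ω)) * f (restrictSpins H (σ ω ∘ θ)) ∂P)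

end

end LoopSoup

/-!
The correlations of the spin field at intensity `1 / 2` are limits of ratios of Gaussian partition
functions, and Gaussian partition functions with nearest-neighbour couplings are reflection
positive.

A loop `γ` multiplies a product of spins `∏ z ∈ C, σ z` by the sign `∏ z ∈ C, (-1) ^ N_γ(z)`, so
the exponential formula for Poisson processes (`integral_prod_spinField`) gives
`E ∏ z ∈ C, σ z = exp (½ ∑ γ, μ(γ) (sign γ - 1))`. The parity of `N_γ(z)` is the number of times
that `γ` crosses a lattice ray from `z` to infinity (`windingNumber_ray`), hence the sign is the
product over the steps of `γ` of signs that are attached to the edges. For loops in a finite box,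
`-log det (1 - P) = ∑ t ≥ 1, tr (P ^ t) / t` sums such weights (`hasSum_pathWeight_div_time`), and
the intensity `½` turns the determinants into `det (1 - P) ^ (-1/2)`, the partition function of a
Gaussian field whose couplings carry the signs (`MirrorGeometry.exp_box_eq`).

Let now `C` consist of faces `A` on the positive side of the line and of mirror images of faces `B`
on the positive side. The rays from `A` are chosen to stay on the positive side, and those from the
images of `B` to be the mirror images of the rays from `B`. Then the form `1 - P` of the
field, where `P` is the matrix of the steps, has the block form
`mirrorBlock` (`MirrorGeometry.one_sub_stepMatrix_eq_mirrorBlock`): the signs of `A` appear on one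
side only, those of `B` on the other side only in the same way, and the two sides interact through
the field on the line and through a positive coupling of some sites to their mirror images. The
latter is decoupled by auxiliary Gaussian variables. When the fields on the two sides are
integrated out, there remains a kernel `(i, j) ↦ det (S i + S j) ^ (-1/2)`, which is positive
semidefinite as the Gram matrix of Gaussian functions in `L²`
(`sum_mul_inv_sqrt_det_mirrorBlock_nonneg`). This gives positivity for linear combinations of
products of spins (`MirrorGeometry.sum_correlation_nonneg`).

Every function of finitely many spins is such a combination. Approximation by continuous functions
in `L²` and truncation extend positivity to all measurable functions for which the expectation
exists (`integral_mul_nonneg_of_spinProd`). The symmetry in `f` and `g` holds because the reflection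
preserves the law of the soup and changes winding numbers only by a sign
(`IsReflection.measurePreserving_soupEquiv`, `IsReflection.spinField_soupEquiv`). Almost sure
finiteness is the Borel–Cantelli lemma: a loop around a face starts within distance `t_γ` of it
(`abs_root_sub_le_time`), and the masses of such loops are summable since there are at most `4 ^ t`
walks of `t` steps from a given vertex, while each has mass at most `(4 + κ) ^ (-t)`
(`summable_near_loops`).
-/

/-! ### Gaussian integrals and mirror-symmetric quadratic forms -/

namespace LoopSoup

open Matrix

open scoped MatrixOrder in
/-- The normalized Gaussian integral of a positive definite quadratic form. -/
theorem integral_exp_neg_pi_mul_quadratic {ι : Type*} [Fintype ι] [DecidableEq ι]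
    {S : Matrix ι ι ℝ} (hS : S.PosDef) :
    ∫ x : ι → ℝ, Real.exp (-Real.pi * (x ⬝ᵥ S *ᵥ x)) = (√S.det)⁻¹ := by
  obtain ⟨B, hB, rfl⟩ : ∃ B : Matrix ι ι ℝ, B.det ≠ 0 ∧ S = Bᵀ * B := by
    obtain ⟨B, hB⟩ := CStarAlgebra.nonneg_iff_eq_star_mul_self.mp hS.posSemidef.nonneg
    refine ⟨B, ?_, by simpa [star_eq_conjTranspose] using hB⟩
    intro h0
    have := hS.det_pos
    rw [hB, det_mul, h0, mul_zero] at this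
    exact lt_irrefl _ this
  have hmp := Real.map_matrix_volume_pi_eq_smul_volume_pi hB
  have hval : ∀ x : ι → ℝ, x ⬝ᵥ (Bᵀ * B) *ᵥ x = toLin' B x ⬝ᵥ toLin' B x := by
    intro x
    rw [← mulVec_mulVec, dotProduct_mulVec, vecMul_transpose, toLin'_apply]
  have hone : ∫ y : ι → ℝ, Real.exp (-Real.pi * (y ⬝ᵥ y)) = 1 := by
    have : ∀ y : ι → ℝ, Real.exp (-Real.pi * (y ⬝ᵥ y)) = ∏ i, Real.exp (-Real.pi * y i ^ 2) := by
      intro y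
      rw [← Real.exp_sum, dotProduct, Finset.mul_sum]
      simp_rw [sq]
    simp_rw [this]
    rw [integral_fintype_prod_volume_eq_prod (fun (_ : ι) (t : ℝ) => Real.exp (-Real.pi * t ^ 2))]
    simp only [integral_gaussian, div_self Real.pi_ne_zero, Real.sqrt_one, Finset.prod_const_one]
  have hmeas : AEMeasurable (toLin' B) (volume : Measure (ι → ℝ)) :=
    (LinearMap.continuous_of_finiteDimensional (toLin' B)).aemeasurable
  calc ∫ x : ι → ℝ, Real.exp (-Real.pi * (x ⬝ᵥ (Bᵀ * B) *ᵥ x))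
      = ∫ x : ι → ℝ, (fun y => Real.exp (-Real.pi * (y ⬝ᵥ y))) (toLin' B x) := by simp_rw [hval]
    _ = ∫ y, Real.exp (-Real.pi * (y ⬝ᵥ y)) ∂(Measure.map (toLin' B) volume) := by
        rw [integral_map hmeas]
        exact Continuous.aestronglyMeasurable (by unfold dotProduct; fun_prop)
    _ = (√(Bᵀ * B).det)⁻¹ := by
        rw [hmp, integral_smul_measure, hone, det_mul, det_transpose, Real.sqrt_mul_self_eq_abs,
          ENNReal.toReal_ofReal (abs_nonneg _), abs_inv, smul_eq_mul, mul_one]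

theorem integrable_exp_neg_pi_mul_quadratic {ι : Type*} [Fintype ι] [DecidableEq ι]
    {S : Matrix ι ι ℝ} (hS : S.PosDef) :
    Integrable fun x : ι → ℝ => Real.exp (-Real.pi * (x ⬝ᵥ S *ᵥ x)) := by
  by_contra h
  have h1 := integral_exp_neg_pi_mul_quadratic hS
  rw [integral_undef h] at h1
  have h2 : (0 : ℝ) < (√S.det)⁻¹ := inv_pos.2 (Real.sqrt_pos.2 hS.det_pos)
  exact h2.ne h1

/-- The kernel `(S, T) ↦ det (S + T) ^ (-1/2)` is positive semidefinite, since it is the `L²` inner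
product of the functions `exp (-π xᵀ S x)` and `exp (-π xᵀ T x)`. -/
theorem sum_mul_inv_sqrt_det_add_nonneg {ι κ : Type*} [Fintype ι] [DecidableEq ι]
    (s : Finset κ) (c : κ → ℝ) (S : κ → Matrix ι ι ℝ)
    (hS : ∀ i ∈ s, ∀ j ∈ s, (S i + S j).PosDef) :
    0 ≤ ∑ i ∈ s, ∑ j ∈ s, c i * c j * (√(S i + S j).det)⁻¹ := by
  have h : ∑ i ∈ s, ∑ j ∈ s, c i * c j * (√(S i + S j).det)⁻¹
      = ∫ x : ι → ℝ, (∑ i ∈ s, c i * Real.exp (-Real.pi * (x ⬝ᵥ S i *ᵥ x))) ^ 2 := by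
    have hsq : ∀ x : ι → ℝ, (∑ i ∈ s, c i * Real.exp (-Real.pi * (x ⬝ᵥ S i *ᵥ x))) ^ 2
        = ∑ i ∈ s, ∑ j ∈ s, c i * c j * Real.exp (-Real.pi * (x ⬝ᵥ (S i + S j) *ᵥ x)) := by
      intro x
      rw [sq, Finset.sum_mul_sum]
      refine Finset.sum_congr rfl fun i _ => Finset.sum_congr rfl fun j _ => ?_
      rw [add_mulVec, dotProduct_add, mul_add, Real.exp_add]
      ring
    simp_rw [hsq]
    rw [integral_finsetSum]
    · refine Finset.sum_congr rfl fun i hi => ?_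
      rw [integral_finsetSum]
      · refine Finset.sum_congr rfl fun j hj => ?_
        rw [integral_const_mul, integral_exp_neg_pi_mul_quadratic (hS i hi j hj)]
      · exact fun j hj => (integrable_exp_neg_pi_mul_quadratic (hS i hi j hj)).const_mul _
    · exact fun i hi => integrable_finsetSum _ fun j hj =>
        (integrable_exp_neg_pi_mul_quadratic (hS i hi j hj)).const_mul _
  rw [h]
  exact integral_nonneg fun x => sq_nonneg _

section Block

variable {n m : Type*} [Fintype n] [DecidableEq n] [Fintype m] [DecidableEq m]

/-- The quadratic form of a field on two mirror images of `n` and on the mirror `m`: the forms `X`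
and `X'` on the two sides are coupled to each other by `-k` between mirror points, and to the
mirror by `U` and `U'`. -/
noncomputable def mirrorBlock (k : n → ℝ) (X X' : Matrix n n ℝ) (U U' : Matrix n m ℝ) :
    Matrix ((n ⊕ n) ⊕ m) ((n ⊕ n) ⊕ m) ℝ :=
  fromBlocks (fromBlocks X (-diagonal k) (-diagonal k) X') (fromRows U U') (fromRows U U')ᵀ 1

/-- The coupling of one side to the mirror, extended by one auxiliary variable for each site
of that side, through which the direct coupling `k` of the two sides is mediated. -/
noncomputable def sideCoupling (k : n → ℝ) (U : Matrix n m ℝ) : Matrix n (m ⊕ n) ℝ :=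
  fromCols U (-diagonal fun i => √(k i))

/-- The effective form of one side on the mirror and the auxiliary variables, i.e. half the unit
form minus the Schur complement term. -/
noncomputable def effectiveForm (k : n → ℝ) (X : Matrix n n ℝ) (U : Matrix n m ℝ) :
    Matrix (m ⊕ n) (m ⊕ n) ℝ :=
  (1 / 2 : ℝ) • (1 : Matrix (m ⊕ n) (m ⊕ n) ℝ)
    - (sideCoupling k U)ᵀ * (X + diagonal k)⁻¹ * sideCoupling k U

/-- The mirror block is the Schur complement of a larger form with one auxiliary variable per site of
one side, in which the two sides no longer interact. Eliminating both sides from the larger form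
leaves the sum of their effective forms, so the determinant factorizes. -/
theorem posDef_effectiveForm_add {k : n → ℝ} (hk : ∀ i, 0 ≤ k i) {X X' : Matrix n n ℝ}
    {U U' : Matrix n m ℝ} (hM : (mirrorBlock k X X' U U').PosDef) :
    (X + diagonal k).PosDef ∧ (X' + diagonal k).PosDef ∧
    (effectiveForm k X U + effectiveForm k X' U').PosDef ∧
    (mirrorBlock k X X' U U').det = (X + diagonal k).det * (X' + diagonal k).det
      * (effectiveForm k X U + effectiveForm k X' U').det := by
  have hK : (diagonal k).PosSemidef := PosSemidef.diagonal hk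
  have hX : (X + diagonal k).PosDef := by
    refine PosDef.add_posSemidef ?_ hK
    exact hM.submatrix (e := fun i : n => (Sum.inl (Sum.inl i) : (n ⊕ n) ⊕ m))
      (fun _ _ h => by simpa using h)
  have hX' : (X' + diagonal k).PosDef := by
    refine PosDef.add_posSemidef ?_ hK
    exact hM.submatrix (e := fun i : n => (Sum.inl (Sum.inr i) : (n ⊕ n) ⊕ m))
      (fun _ _ h => by simpa using h)
  set Y := X + diagonal k with hY
  set Y' := X' + diagonal k with hY'
  set R : Matrix ((n ⊕ n) ⊕ m) n ℝ :=
    fromRows (fromRows (-diagonal fun i => √(k i)) (-diagonal fun i => √(k i))) 0 with hR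
  set D : Matrix (n ⊕ n) (n ⊕ n) ℝ := fromBlocks Y 0 0 Y' with hD
  set V : Matrix (n ⊕ n) (m ⊕ n) ℝ := fromRows (sideCoupling k U) (sideCoupling k U') with hV
  -- the extended form, with the auxiliary variables either last or next to the mirror
  set N : Matrix (((n ⊕ n) ⊕ m) ⊕ n) (((n ⊕ n) ⊕ m) ⊕ n) ℝ :=
    fromBlocks (fromBlocks D (fromRows U U') (fromRows U U')ᵀ 1) R Rᵀ 1 with hN
  have hNsub : N.submatrix (Equiv.sumAssoc (n ⊕ n) m n).symm (Equiv.sumAssoc (n ⊕ n) m n).symm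
      = fromBlocks D V Vᵀ 1 := by
    ext ((i | i) | i | i) ((j | j) | j | j) <;>
      simp [hN, hR, hV, hD, sideCoupling, one_apply]
  -- eliminating the auxiliary variables restores the coupling `-k` and turns `Y` back into `X`
  have hNM : fromBlocks D (fromRows U U') (fromRows U U')ᵀ 1 - R * Rᵀ
      = mirrorBlock k X X' U U' := by
    have hsq : ∀ i, √(k i) * √(k i) = k i := fun i => Real.mul_self_sqrt (hk i)
    ext ((i | i) | i) ((j | j) | j) <;>
      simp [hR, hD, hY, hY', mirrorBlock, mul_apply, diagonal_apply, Finset.sum_ite_eq, one_apply]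
    all_goals
      by_cases hij : i = j
      · subst hij; simp [hsq]
      · simp [hij]
  have hDinv : D⁻¹ = fromBlocks Y⁻¹ 0 0 Y'⁻¹ := by
    refine inv_eq_left_inv ?_
    rw [hD, fromBlocks_multiply]
    simp [nonsing_inv_mul _ ((isUnit_iff_isUnit_det _).1 hX.isUnit),
      nonsing_inv_mul _ ((isUnit_iff_isUnit_det _).1 hX'.isUnit)]
  have hDdet : D.det = Y.det * Y'.det := by rw [hD, det_fromBlocks_zero₂₁]
  -- eliminating the two sides instead leaves the effective forms
  have hSchur : 1 - Vᵀ * D⁻¹ * V = effectiveForm k X U + effectiveForm k X' U' := by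
    rw [hDinv, hV, transpose_fromRows, fromCols_mul_fromBlocks, fromCols_mul_fromRows]
    simp only [effectiveForm, Matrix.mul_zero, add_zero, zero_add]
    rw [← hY, ← hY']
    have : (1 : Matrix (m ⊕ n) (m ⊕ n) ℝ)
        = (1 / 2 : ℝ) • (1 : Matrix (m ⊕ n) (m ⊕ n) ℝ)
          + (1 / 2 : ℝ) • (1 : Matrix (m ⊕ n) (m ⊕ n) ℝ) := by
      rw [← add_smul]; norm_num
    nth_rewrite 1 [this]
    abel
  have hDpd : D.PosDef := by
    refine ((PosSemidef.posDef_iff_det_ne_zero ?_).2 ?_)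
    · have := hX.isUnit.invertible
      have := (PosDef.fromBlocks₁₁ (0 : Matrix n n ℝ) Y' hX).2 (by simpa using hX'.posSemidef)
      simpa [hD] using this
    · rw [hDdet]; exact (mul_pos hX.det_pos hX'.det_pos).ne'
  have hNpsd : N.PosSemidef := by
    have : Invertible (1 : Matrix n n ℝ) := invertibleOne
    have := (PosDef.fromBlocks₂₂ (fromBlocks D (fromRows U U') (fromRows U U')ᵀ 1) R
      (D := (1 : Matrix n n ℝ)) PosDef.one).2
      (by simpa [hNM] using hM.posSemidef)
    simpa [hN] using this
  have hNdet : N.det = (mirrorBlock k X X' U U').det := by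
    rw [hN, det_fromBlocks_one₂₂, hNM]
  have hNdet' : N.det = D.det * (effectiveForm k X U + effectiveForm k X' U').det := by
    have := hDpd.isUnit.invertible
    rw [← det_submatrix_equiv_self (Equiv.sumAssoc (n ⊕ n) m n).symm N, hNsub, det_fromBlocks₁₁,
      invOf_eq_nonsing_inv, hSchur]
  have hdet : (mirrorBlock k X X' U U').det = Y.det * Y'.det
      * (effectiveForm k X U + effectiveForm k X' U').det := by
    rw [← hNdet, hNdet', hDdet]
  refine ⟨hX, hX', ?_, hdet⟩
  refine (PosSemidef.posDef_iff_det_ne_zero ?_).2 ?_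
  · have := hDpd.isUnit.invertible
    have h1 : (fromBlocks D V Vᵀ 1).PosSemidef := by
      rw [← hNsub]; exact hNpsd.submatrix _
    have h2 := (PosDef.fromBlocks₁₁ V 1 hDpd).1 (by simpa using h1)
    rw [← hSchur]
    simpa using h2
  · intro h0
    have := hM.det_pos
    rw [hdet, h0, mul_zero] at this
    exact lt_irrefl _ this

/-- Reflection positivity of a Gaussian field, in terms of its partition function: up to factors
that depend on one index only, `det (mirrorBlock ..) ^ (-1/2)` is the kernel of
`sum_mul_inv_sqrt_det_add_nonneg` at the effective forms of the two sides. -/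
theorem sum_mul_inv_sqrt_det_mirrorBlock_nonneg {ι : Type*} (s : Finset ι) (c : ι → ℝ)
    {k : n → ℝ} (hk : ∀ i, 0 ≤ k i) (X : ι → Matrix n n ℝ) (U : ι → Matrix n m ℝ)
    (hM : ∀ i ∈ s, ∀ j ∈ s, (mirrorBlock k (X i) (X j) (U i) (U j)).PosDef) :
    0 ≤ ∑ i ∈ s, ∑ j ∈ s, c i * c j * (√(mirrorBlock k (X i) (X j) (U i) (U j)).det)⁻¹ := by
  have h := sum_mul_inv_sqrt_det_add_nonneg s
    (fun i => c i * (√(X i + diagonal k).det)⁻¹) (fun i => effectiveForm k (X i) (U i))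
    (fun i hi j hj => (posDef_effectiveForm_add hk (hM i hi j hj)).2.2.1)
  refine h.trans_eq (Finset.sum_congr rfl fun i hi => Finset.sum_congr rfl fun j hj => ?_)
  obtain ⟨h1, h2, h3, h4⟩ := posDef_effectiveForm_add hk (hM i hi j hj)
  rw [h4, Real.sqrt_mul (mul_pos h1.det_pos h2.det_pos).le, Real.sqrt_mul h1.det_pos.le]
  simp only [mul_inv]
  ring

end Block

section LogDet

variable {n : Type*} [Fintype n] [DecidableEq n]

theorem trace_pow_eq_sum_eigenvalues_pow {A : Matrix n n ℝ} (hA : A.IsHermitian) (t : ℕ) :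
    (A ^ t).trace = ∑ i, hA.eigenvalues i ^ t := by
  conv_lhs => rw [hA.spectral_theorem, ← map_pow, Unitary.conjStarAlgAut_apply, trace_mul_cycle,
    Unitary.coe_star_mul_self, one_mul, diagonal_pow, trace_diagonal]
  simp

theorem det_one_sub_eq_prod_eigenvalues {A : Matrix n n ℝ} (hA : A.IsHermitian) :
    (1 - A).det = ∏ i, (1 - hA.eigenvalues i) := by
  have h := hA.charpoly_eq
  have h2 := A.eval_charpoly 1
  rw [h, Polynomial.eval_prod] at h2
  simpa using h2.symm

/-- By Gershgorin's circle theorem. -/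
theorem abs_eigenvalues_le_of_row_sum_le {A : Matrix n n ℝ} (hA : A.IsHermitian) {r : ℝ}
    (hr : ∀ i, ∑ j, |A i j| ≤ r) (i : n) : |hA.eigenvalues i| ≤ r := by
  have h1 : Module.End.HasEigenvalue (toLin' A) (hA.eigenvalues i) := by
    rw [Module.End.hasEigenvalue_iff_mem_spectrum, spectrum_toLin']
    exact hA.eigenvalues_mem_spectrum_real i
  obtain ⟨k, hk⟩ := eigenvalue_mem_ball h1
  rw [mem_closedBall_iff_norm, Real.norm_eq_abs] at hk
  have h2 := hr k
  rw [← Finset.add_sum_erase _ _ (Finset.mem_univ k)] at h2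
  simp only [Real.norm_eq_abs] at hk
  have h3 : |hA.eigenvalues i| ≤ |hA.eigenvalues i - A k k| + |A k k| := by
    simpa using abs_add_le (hA.eigenvalues i - A k k) (A k k)
  linarith

theorem posDef_one_sub_of_row_sum_le {A : Matrix n n ℝ} (hA : A.IsHermitian) {r : ℝ} (hr1 : r < 1)
    (hr : ∀ i, ∑ j, |A i j| ≤ r) : (1 - A).PosDef := by
  have hH : (1 - A).IsHermitian := isHermitian_one.sub hA
  rw [hH.posDef_iff_eigenvalues_pos]
  intro i
  have h1 : Module.End.HasEigenvalue (toLin' (1 - A)) (hH.eigenvalues i) := by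
    rw [Module.End.hasEigenvalue_iff_mem_spectrum, spectrum_toLin']
    exact hH.eigenvalues_mem_spectrum_real i
  obtain ⟨k, hk⟩ := eigenvalue_mem_ball h1
  rw [mem_closedBall_iff_norm, Real.norm_eq_abs] at hk
  have h2 := hr k
  rw [← Finset.add_sum_erase _ _ (Finset.mem_univ k)] at h2
  have h4 : ∑ j ∈ Finset.univ.erase k, ‖(1 - A) k j‖ = ∑ j ∈ Finset.univ.erase k, |A k j| :=
    Finset.sum_congr rfl fun j hj => by
      rw [Matrix.sub_apply, one_apply_ne (Finset.ne_of_mem_erase hj).symm, zero_sub, norm_neg,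
        Real.norm_eq_abs]
  rw [h4, Matrix.sub_apply, one_apply_eq] at hk
  have := neg_abs_le (hH.eigenvalues i - (1 - A k k))
  have := le_abs_self (A k k)
  linarith

/-- The expansion `-log det (1 - A) = ∑ t ≥ 1, tr (A ^ t) / t`. -/
theorem hasSum_trace_pow_div {A : Matrix n n ℝ} (hA : A.IsHermitian) {r : ℝ} (hr1 : r < 1)
    (hr : ∀ i, ∑ j, |A i j| ≤ r) :
    HasSum (fun t : ℕ => (A ^ (t + 1)).trace / (t + 1)) (-Real.log (1 - A).det) := by
  have hlt : ∀ i, |hA.eigenvalues i| < 1 := fun i =>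
    (abs_eigenvalues_le_of_row_sum_le hA hr i).trans_lt hr1
  have h : HasSum (fun t : ℕ => ∑ i, hA.eigenvalues i ^ (t + 1) / ((t : ℝ) + 1))
      (∑ i, -Real.log (1 - hA.eigenvalues i)) :=
    hasSum_sum fun i _ => Real.hasSum_pow_div_log_of_abs_lt_one (hlt i)
  convert h using 1
  · ext t
    rw [trace_pow_eq_sum_eigenvalues_pow hA, Finset.sum_div]
  · rw [det_one_sub_eq_prod_eigenvalues hA, Real.log_prod, Finset.sum_neg_distrib]
    intro i _
    have := (abs_lt.1 (hlt i)).2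
    linarith

end LogDet

end LoopSoup

/-! ### Winding numbers, rays and reflections -/

namespace LoopSoup

/-- The coordinate of the vertex `x` along the direction `d`, measured from the centre of the
face `z` and doubled in order to be an integer. -/
def along (d : ℤ × ℤ) (z : Face) (x : ℤ × ℤ) : ℤ :=
  d.1 * (2 * x.1 - 2 * z.1 - 1) + d.2 * (2 * x.2 - 2 * z.2 - 1)

/-- The coordinate of the vertex `x` perpendicular to the direction `d`, measured from the centre
of the face `z` and doubled in order to be an integer. -/
def across (d : ℤ × ℤ) (z : Face) (x : ℤ × ℤ) : ℤ :=
  d.1 * (2 * x.2 - 2 * z.2 - 1) - d.2 * (2 * x.1 - 2 * z.1 - 1)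

/-- The lattice edge `xy` crosses the ray that starts at the centre of `z` in the direction `d`. -/
def CrossesRay (d : ℤ × ℤ) (z : Face) (x y : ℤ × ℤ) : Prop :=
  0 < along d z x ∧ 0 < along d z y ∧ across d z x * across d z y < 0

instance (d : ℤ × ℤ) (z : Face) (x y : ℤ × ℤ) : Decidable (CrossesRay d z x y) := by
  unfold CrossesRay; infer_instance

/-- The sign `-1` for the edges that cross the ray from `z` in the direction `d`. -/
def raySign (d : ℤ × ℤ) (z : Face) (x y : ℤ × ℤ) : ℤˣ := if CrossesRay d z x y then -1 else 1

theorem raySign_comm (d : ℤ × ℤ) (z : Face) (x y : ℤ × ℤ) : raySign d z x y = raySign d z y x := by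
  have : CrossesRay d z x y ↔ CrossesRay d z y x := by
    unfold CrossesRay
    rw [mul_comm (across d z x)]
    tauto
  simp only [raySign, this]

/-- The lattice directions. -/
def IsDirection (d : ℤ × ℤ) : Prop := d = (1, 0) ∨ d = (-1, 0) ∨ d = (0, 1) ∨ d = (0, -1)

theorem adj_cases {x y : ℤ × ℤ} (h : squareLattice.Adj x y) :
    (y.1 = x.1 + 1 ∧ y.2 = x.2) ∨ (y.1 = x.1 - 1 ∧ y.2 = x.2) ∨
    (y.1 = x.1 ∧ y.2 = x.2 + 1) ∨ (y.1 = x.1 ∧ y.2 = x.2 - 1) := by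
  have h' : |x.1 - y.1| + |x.2 - y.2| = 1 := h
  rcases abs_cases (x.1 - y.1) with h1 | h1 <;> rcases abs_cases (x.2 - y.2) with h2 | h2 <;> omega

/-- The position of `x` relative to the centre of `z`, rotated such that `d` becomes the negative
real axis, where the argument has its branch cut. -/
noncomputable def rotated (d : ℤ × ℤ) (z : Face) (x : ℤ × ℤ) : ℂ :=
  ⟨-(along d z x : ℝ) / 2, -(across d z x : ℝ) / 2⟩

theorem rotated_eq (d : ℤ × ℤ) (z : Face) (x : ℤ × ℤ) :
    rotated d z x = -(⟨d.1, -d.2⟩ : ℂ) * (vertexPoint x - faceCenter z) := by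
  apply Complex.ext
  · simp [rotated, along, vertexPoint, faceCenter]; ring
  · simp [rotated, across, vertexPoint, faceCenter]; ring

theorem stepAngle_eq_arg_rotated {d : ℤ × ℤ} (hd : IsDirection d) (z : Face) (x y : ℤ × ℤ) :
    stepAngle z x y = Complex.arg (rotated d z y / rotated d z x) := by
  have h0 : (-(⟨d.1, -d.2⟩ : ℂ)) ≠ 0 := by
    intro h
    have h1 := congrArg Complex.re h
    have h2 := congrArg Complex.im h
    rcases hd with rfl | rfl | rfl | rfl <;> simp at h1 h2
  rw [stepAngle, rotated_eq, rotated_eq, mul_div_mul_left _ _ h0]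

/-- The change of the branch of the argument along a step, if the ends of the step are off the real
axis and either on the same side of it, or in the same half-plane bounded by the imaginary axis. -/
theorem exists_arg_div_eq {a b : ℂ} (ha : a.im ≠ 0) (hb : b.im ≠ 0)
    (hc : 0 < a.im * b.im ∨ (0 < a.re ∧ 0 < b.re) ∨ (a.re < 0 ∧ b.re < 0)) :
    ∃ k : ℤ, Complex.arg (b / a) = Complex.arg b - Complex.arg a + 2 * Real.pi * k ∧
      k.negOnePow = (if a.re < 0 ∧ b.re < 0 ∧ a.im * b.im < 0 then -1 else 1) ∧
      (¬(a.re < 0 ∧ b.re < 0 ∧ a.im * b.im < 0) → k = 0) := by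
  have ha0 : a ≠ 0 := fun h => ha (by simp [h])
  have hb0 : b ≠ 0 := fun h => hb (by simp [h])
  obtain ⟨k, hk⟩ := Real.Angle.angle_eq_iff_two_pi_dvd_sub.1 (Complex.arg_div_coe_angle hb0 ha0)
  have hpi := Real.pi_pos
  have hq1 := Complex.neg_pi_lt_arg (b / a)
  have hq2 := Complex.arg_le_pi (b / a)
  have hu : ∀ w : ℂ, 0 < w.im → 0 < Complex.arg w ∧ Complex.arg w < Real.pi := fun w hw => by
    refine ⟨?_, ?_⟩
    · rcases (Complex.arg_nonneg_iff.2 hw.le).lt_or_eq with h | h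
      · exact h
      · have := (Complex.arg_eq_zero_iff.1 h.symm).2
        exact absurd this hw.ne'
    · exact Complex.arg_lt_pi_iff.2 (Or.inr hw.ne')
  have hl : ∀ w : ℂ, w.im < 0 → -Real.pi < Complex.arg w ∧ Complex.arg w < 0 := fun w hw =>
    ⟨Complex.neg_pi_lt_arg w, Complex.arg_neg_iff.2 hw⟩
  have zero_of : |Complex.arg b - Complex.arg a| < Real.pi → k = 0 := by
    intro h
    rw [abs_lt] at h
    have h1 : (k : ℝ) < 1 := by nlinarith
    have h2 : (-1 : ℝ) < k := by nlinarith
    have h1' : k < 1 := by exact_mod_cast h1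
    have h2' : -1 < k := by exact_mod_cast h2
    omega
  refine ⟨k, by linarith, ?_⟩
  by_cases hcase : a.re < 0 ∧ b.re < 0 ∧ a.im * b.im < 0
  · rw [if_pos hcase]
    refine ⟨?_, fun h => absurd hcase h⟩
    obtain ⟨har, hbr, hab⟩ := hcase
    have hbig : ∀ w : ℂ, w.re < 0 → Real.pi / 2 < |Complex.arg w| := fun w hw => by
      by_contra h
      exact hw.not_ge (Complex.abs_arg_le_pi_div_two_iff.1 (not_lt.1 h))
    have hA := hbig a har
    have hB := hbig b hbr
    have hk1 : k = 1 ∨ k = -1 := by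
      rcases mul_neg_iff.1 hab with ⟨h1, h2⟩ | ⟨h1, h2⟩
      · left
        obtain ⟨p1, p2⟩ := hu a h1
        obtain ⟨q1, q2⟩ := hl b h2
        rw [abs_of_pos p1] at hA
        rw [abs_of_neg q2] at hB
        have h1 : (k : ℝ) < 2 := by nlinarith
        have h2 : (0 : ℝ) < k := by nlinarith
        have h1' : k < 2 := by exact_mod_cast h1
        have h2' : 0 < k := by exact_mod_cast h2
        omega
      · right
        obtain ⟨p1, p2⟩ := hl a h1
        obtain ⟨q1, q2⟩ := hu b h2
        rw [abs_of_neg p2] at hA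
        rw [abs_of_pos q1] at hB
        have h1 : (k : ℝ) < 0 := by nlinarith
        have h2 : (-2 : ℝ) < k := by nlinarith
        have h1' : k < 0 := by exact_mod_cast h1
        have h2' : -2 < k := by exact_mod_cast h2
        omega
    rcases hk1 with rfl | rfl <;> simp
  · rw [if_neg hcase]
    have hk0 : k = 0 := by
      apply zero_of
      rw [abs_lt]
      rcases hc with h | ⟨h1, h2⟩ | ⟨h1, h2⟩
      · rcases mul_pos_iff.1 h with ⟨h1, h2⟩ | ⟨h1, h2⟩
        · have := hu a h1; have := hu b h2
          constructor <;> linarith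
        · have := hl a h1; have := hl b h2
          constructor <;> linarith
      · have h3 := abs_lt.1 (Complex.abs_arg_lt_pi_div_two_iff.2 (Or.inl h1))
        have h4 := abs_lt.1 (Complex.abs_arg_lt_pi_div_two_iff.2 (Or.inl h2))
        constructor <;> linarith
      · have h : 0 < a.im * b.im :=
          lt_of_le_of_ne (not_lt.1 fun h => hcase ⟨h1, h2, h⟩) (mul_ne_zero ha hb).symm
        rcases mul_pos_iff.1 h with ⟨h1, h2⟩ | ⟨h1, h2⟩
        · have := hu a h1; have := hu b h2
          constructor <;> linarith
        · have := hl a h1; have := hl b h2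
          constructor <;> linarith
    subst hk0
    simp

/-- Along a step, the branch of the argument with its cut on the ray in direction `d` follows the
change of angle, except for a jump by `±2π` if the step crosses the ray. -/
theorem exists_stepAngle_eq {d : ℤ × ℤ} (hd : IsDirection d) (z : Face) {x y : ℤ × ℤ}
    (h : squareLattice.Adj x y) :
    ∃ k : ℤ, stepAngle z x y = Complex.arg (rotated d z y) - Complex.arg (rotated d z x)
        + 2 * Real.pi * k ∧ k.negOnePow = raySign d z x y ∧ (¬CrossesRay d z x y → k = 0) := by
  have hne : ∀ v, across d z v ≠ 0 := fun v => by
    unfold across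
    rcases hd with rfl | rfl | rfl | rfl <;> dsimp only <;> omega
  have him : ∀ v, (rotated d z v).im ≠ 0 := fun v => by
    simp only [rotated, ne_eq, div_eq_zero_iff, neg_eq_zero, Int.cast_eq_zero]
    simpa using hne v
  have hre : ∀ v, (rotated d z v).re < 0 ↔ 0 < along d z v := fun v => by
    have : (rotated d z v).re = -(along d z v : ℝ) / 2 := rfl
    rw [this, ← Int.cast_pos (R := ℝ)]
    constructor <;> intro <;> linarith
  have hre' : ∀ v, 0 < (rotated d z v).re ↔ along d z v < 0 := fun v => by
    have : (rotated d z v).re = -(along d z v : ℝ) / 2 := rfl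
    rw [this, ← Int.cast_lt_zero (R := ℝ)]
    constructor <;> intro <;> linarith
  have hmul : (rotated d z x).im * (rotated d z y).im
      = ((across d z x * across d z y : ℤ) : ℝ) / 4 := by
    simp only [rotated]; push_cast; ring
  have hlt : (rotated d z x).im * (rotated d z y).im < 0 ↔ across d z x * across d z y < 0 := by
    rw [hmul, ← Int.cast_lt_zero (R := ℝ)]
    constructor <;> intro <;> linarith
  have hpos : 0 < across d z x * across d z y → 0 < (rotated d z x).im * (rotated d z y).im := by
    intro h
    rw [hmul]
    have : (0 : ℝ) < ((across d z x * across d z y : ℤ) : ℝ) := Int.cast_pos.2 h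
    linarith
  have hcr : ((rotated d z x).re < 0 ∧ (rotated d z y).re < 0 ∧
      (rotated d z x).im * (rotated d z y).im < 0) ↔ CrossesRay d z x y := by
    rw [hre, hre, hlt]; rfl
  have hc : 0 < across d z x * across d z y ∨ (along d z x < 0 ∧ along d z y < 0) ∨
      (0 < along d z x ∧ 0 < along d z y) := by
    -- a step along `d` preserves the odd number `across`, any other one the odd number `along`
    have key : across d z y = across d z x ∨ (along d z y = along d z x ∧ along d z x ≠ 0) := by
      unfold across along
      rcases adj_cases h with ⟨h1, h2⟩ | ⟨h1, h2⟩ | ⟨h1, h2⟩ | ⟨h1, h2⟩ <;>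
        rcases hd with rfl | rfl | rfl | rfl <;> dsimp only <;> rw [h1, h2] <;> omega
    rcases key with h1 | ⟨h1, h2⟩
    · left
      rw [h1]
      exact mul_self_pos.2 (hne x)
    · right
      rcases h2.lt_or_gt with h3 | h3
      · exact Or.inl ⟨h3, by rwa [h1]⟩
      · exact Or.inr ⟨h3, by rwa [h1]⟩
  have := exists_arg_div_eq (him x) (him y) (by
    rw [hre, hre, hre', hre']
    exact hc.imp_left hpos)
  simp only [hcr] at this
  rw [stepAngle_eq_arg_rotated hd]
  exact this

theorem exists_totalAngle_eq {d : ℤ × ℤ} (hd : IsDirection d) (z : Face) {x y : ℤ × ℤ}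
    (p : squareLattice.Walk x y) :
    ∃ k : ℤ, totalAngle z p = Complex.arg (rotated d z y) - Complex.arg (rotated d z x)
        + 2 * Real.pi * k ∧ k.negOnePow = (p.darts.map fun e => raySign d z e.fst e.snd).prod ∧
        ((∀ e ∈ p.darts, ¬CrossesRay d z e.fst e.snd) → k = 0) := by
  induction p with
  | nil => exact ⟨0, by simp [totalAngle], by simp, fun _ => rfl⟩
  | @cons u v w h p ih =>
    obtain ⟨k, hk1, hk2, hk3⟩ := ih
    obtain ⟨l, hl1, hl2, hl3⟩ := exists_stepAngle_eq hd z h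
    refine ⟨l + k, ?_, ?_, ?_⟩
    · have : totalAngle z (SimpleGraph.Walk.cons h p) = stepAngle z u v + totalAngle z p := by
        simp [totalAngle]
      rw [this, hk1, hl1]; push_cast; ring
    · rw [Int.negOnePow_add, hk2, hl2]; simp
    · intro hn
      rw [hl3 (by simpa using hn ⟨(u, v), h⟩ (by simp)),
        hk3 fun e he => hn e (by simp [he])]
      rfl

/-- The parity of the winding number is the parity of the number of crossings of any lattice ray
that starts at the face; without crossings the winding number vanishes. -/
theorem windingNumber_ray {d : ℤ × ℤ} (hd : IsDirection d) (γ : Loop) (z : Face) :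
    (windingNumber γ z).negOnePow = (γ.2.1.darts.map fun e => raySign d z e.fst e.snd).prod ∧
    ((∀ e ∈ γ.2.1.darts, ¬CrossesRay d z e.fst e.snd) → windingNumber γ z = 0) := by
  obtain ⟨k, hk1, hk2, hk3⟩ := exists_totalAngle_eq hd z γ.2.1
  have hk : windingNumber γ z = k := by
    have h := windingNumber_mul_two_pi γ z
    rw [hk1, sub_self, zero_add, mul_comm] at h
    have hpi : (2 * Real.pi) ≠ 0 := by positivity
    exact_mod_cast mul_left_cancel₀ hpi h
  rw [hk]
  exact ⟨hk2, hk3⟩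

theorem abs_sub_le_length_of_mem_support {x y v : ℤ × ℤ} (p : squareLattice.Walk x y)
    (hv : v ∈ p.support) : |v.1 - x.1| ≤ p.length ∧ |v.2 - x.2| ≤ p.length := by
  induction p with
  | nil => simp_all
  | @cons a b c h p ih =>
    rw [SimpleGraph.Walk.support_cons, List.mem_cons] at hv
    rw [SimpleGraph.Walk.length_cons]
    rcases hv with rfl | hv
    · simp; omega
    · obtain ⟨h1, h2⟩ := ih hv
      push_cast
      rw [abs_le] at h1 h2 ⊢
      rw [abs_le]
      rcases adj_cases h with ⟨h3, h4⟩ | ⟨h3, h4⟩ | ⟨h3, h4⟩ | ⟨h3, h4⟩ <;> omega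

/-- A loop which winds around a face starts close to it, since it crosses every ray. -/
theorem abs_root_sub_le_time {γ : Loop} {z : Face} (h : windingNumber γ z ≠ 0) :
    |γ.1.1 - z.1| ≤ γ.time ∧ |γ.1.2 - z.2| ≤ γ.time := by
  have key : ∀ d : ℤ × ℤ, IsDirection d → ∃ v, 0 < along d z v ∧
      |v.1 - γ.1.1| ≤ γ.time ∧ |v.2 - γ.1.2| ≤ γ.time := by
    intro d hd
    by_contra hcon
    push Not at hcon
    refine h ((windingNumber_ray hd γ z).2 fun e he hcr => ?_)
    have hs := abs_sub_le_length_of_mem_support _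
      (SimpleGraph.Walk.dart_fst_mem_support_of_mem_darts _ he)
    exact absurd hs.2 (not_le.2 (hcon e.fst hcr.1 hs.1))
  obtain ⟨a, ha, ha1, ha2⟩ := key (1, 0) (by simp [IsDirection])
  obtain ⟨b, hb, hb1, hb2⟩ := key (-1, 0) (by simp [IsDirection])
  obtain ⟨c, hc, hc1, hc2⟩ := key (0, 1) (by simp [IsDirection])
  obtain ⟨e, he, he1, he2⟩ := key (0, -1) (by simp [IsDirection])
  simp only [along] at ha hb hc he
  rw [abs_le] at *
  rw [abs_le]
  omega

/-- A lattice symmetry `ϑ` of the vertices, together with its action `θ` on the faces, which is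
a reflection of the plane. -/
structure IsReflection (ϑ : ℤ × ℤ → ℤ × ℤ) (θ : Face → Face) : Prop where
  vertex_involutive : Function.Involutive ϑ
  face_involutive : Function.Involutive θ
  adj : ∀ x y, squareLattice.Adj x y → squareLattice.Adj (ϑ x) (ϑ y)
  conj : ∃ η : ℂ, η ≠ 0 ∧ ∀ v z,
    vertexPoint (ϑ v) - faceCenter (θ z) = η * (starRingEnd ℂ) (vertexPoint v - faceCenter z)

/-- The value `π` is the one where the argument does not commute with complex conjugation. -/
theorem stepAngle_ne_pi (z : Face) {x y : ℤ × ℤ} (h : squareLattice.Adj x y) :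
    stepAngle z x y ≠ Real.pi := by
  intro hpi
  have h1 := (Complex.arg_eq_pi_iff.1 hpi).1
  rw [Complex.div_re, ← add_div] at h1
  have h2 : (vertexPoint y - faceCenter z).re * (vertexPoint x - faceCenter z).re
      + (vertexPoint y - faceCenter z).im * (vertexPoint x - faceCenter z).im < 0 := by
    by_contra h3
    exact absurd h1 (not_lt.2 (div_nonneg (not_lt.1 h3) (Complex.normSq_nonneg _)))
  have h3 : (2 * y.1 - 2 * z.1 - 1) * (2 * x.1 - 2 * z.1 - 1)
      + (2 * y.2 - 2 * z.2 - 1) * (2 * x.2 - 2 * z.2 - 1) < 0 := by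
    have : (((2 * y.1 - 2 * z.1 - 1) * (2 * x.1 - 2 * z.1 - 1)
      + (2 * y.2 - 2 * z.2 - 1) * (2 * x.2 - 2 * z.2 - 1) : ℤ) : ℝ) < 0 := by
      simp only [vertexPoint, faceCenter, Complex.sub_re, Complex.sub_im] at h2
      push_cast
      linarith
    exact_mod_cast this
  have h4 : 0 < (2 * x.1 - 2 * z.1 - 1) ^ 2 := by
    have : (2 * x.1 - 2 * z.1 - 1) ≠ 0 := by omega
    positivity
  have h5 : 0 < (2 * x.2 - 2 * z.2 - 1) ^ 2 := by
    have : (2 * x.2 - 2 * z.2 - 1) ≠ 0 := by omega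
    positivity
  rcases adj_cases h with ⟨h6, h7⟩ | ⟨h6, h7⟩ | ⟨h6, h7⟩ | ⟨h6, h7⟩ <;> rw [h6, h7] at h3
  · nlinarith [sq_nonneg (2 * x.1 - 2 * z.1)]
  · nlinarith [sq_nonneg (2 * x.1 - 2 * z.1 - 2)]
  · nlinarith [sq_nonneg (2 * x.2 - 2 * z.2)]
  · nlinarith [sq_nonneg (2 * x.2 - 2 * z.2 - 2)]

namespace IsReflection

variable {ϑ : ℤ × ℤ → ℤ × ℤ} {θ : Face → Face}

theorem stepAngle_eq (hr : IsReflection ϑ θ) (z : Face) {x y : ℤ × ℤ}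
    (h : squareLattice.Adj x y) : stepAngle (θ z) (ϑ x) (ϑ y) = -stepAngle z x y := by
  obtain ⟨η, hη, hc⟩ := hr.conj
  rw [stepAngle, hc, hc, mul_div_mul_left _ _ hη, ← map_div₀, Complex.arg_conj]
  exact if_neg (stepAngle_ne_pi z h)

/-- The reflection as a homomorphism of graphs. -/
def hom (hr : IsReflection ϑ θ) : squareLattice →g squareLattice := ⟨ϑ, hr.adj _ _⟩

theorem totalAngle_map (hr : IsReflection ϑ θ) (z : Face) {x y : ℤ × ℤ}
    (p : squareLattice.Walk x y) : totalAngle (θ z) (p.map hr.hom) = -totalAngle z p := by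
  induction p with
  | nil => simp [totalAngle]
  | @cons u v w h p ih =>
    have h1 : totalAngle z (SimpleGraph.Walk.cons h p) = stepAngle z u v + totalAngle z p := by
      simp [totalAngle]
    have h2 : totalAngle (θ z) ((SimpleGraph.Walk.cons h p).map hr.hom)
        = stepAngle (θ z) (ϑ u) (ϑ v) + totalAngle (θ z) (p.map hr.hom) := by
      simp [totalAngle, hom]
    rw [h1, h2, ih, hr.stepAngle_eq z h]
    ring

/-- A homomorphism that fixes all vertices fixes all loops. The hypothesis is pointwise since the
composition of two homomorphisms is in general not definitionally the identity. -/
theorem sigma_map_eq (f : squareLattice →g squareLattice) (hf : ∀ x, f x = x) (γ : Loop) :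
    (⟨f γ.1, γ.2.1.map f, γ.2.2.trans_eq (SimpleGraph.Walk.length_map f γ.2.1).symm⟩ : Loop) = γ := by
  obtain rfl : f = SimpleGraph.Hom.id := by ext x : 1; exact hf x
  obtain ⟨v, p, hp⟩ := γ
  simp

/-- The reflection of loops. -/
def loopEquiv (hr : IsReflection ϑ θ) : Loop ≃ Loop :=
  Function.Involutive.toPerm
    (fun γ : Loop => (⟨hr.hom γ.1, γ.2.1.map hr.hom,
      γ.2.2.trans_eq (SimpleGraph.Walk.length_map hr.hom γ.2.1).symm⟩ : Loop)) (by
      intro γ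
      have := sigma_map_eq (hr.hom.comp hr.hom) (fun x => hr.vertex_involutive x) γ
      simp only [SimpleGraph.Walk.map_map]
      exact this)

theorem time_loopEquiv (hr : IsReflection ϑ θ) (γ : Loop) : (hr.loopEquiv γ).time = γ.time :=
  SimpleGraph.Walk.length_map hr.hom γ.2.1

/-- A reflection reverses the orientation, hence the sign of winding numbers. -/
theorem windingNumber_loopEquiv (hr : IsReflection ϑ θ) (γ : Loop) (z : Face) :
    windingNumber (hr.loopEquiv γ) (θ z) = -windingNumber γ z := by
  have h1 := windingNumber_mul_two_pi γ z
  have h2 := windingNumber_mul_two_pi (hr.loopEquiv γ) (θ z)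
  have h3 : totalAngle (θ z) (hr.loopEquiv γ).2.1 = -totalAngle z γ.2.1 := hr.totalAngle_map z _
  rw [h3, ← h1] at h2
  have hpi : (2 * Real.pi) ≠ 0 := by positivity
  have : (windingNumber (hr.loopEquiv γ) (θ z) : ℝ) = -windingNumber γ z := by
    apply mul_right_cancel₀ hpi
    linarith
  exact_mod_cast this

end IsReflection

end LoopSoup

/-! ### Walks, loops and determinants -/

namespace LoopSoup

open scoped ENNReal

/-- The four neighbours of a vertex. -/
def nbrs (x : ℤ × ℤ) : Finset (ℤ × ℤ) :=
  {(x.1 + 1, x.2), (x.1 - 1, x.2), (x.1, x.2 + 1), (x.1, x.2 - 1)}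

theorem mem_nbrs_of_adj {x y : ℤ × ℤ} (h : squareLattice.Adj x y) : y ∈ nbrs x := by
  simp only [nbrs, Finset.mem_insert, Finset.mem_singleton, Prod.ext_iff]
  exact adj_cases h

theorem card_nbrs_le (x : ℤ × ℤ) : (nbrs x).card ≤ 4 := Finset.card_le_four

noncomputable instance : squareLattice.LocallyFinite := fun x =>
  ((nbrs x).finite_toSet.subset fun _ hy => mem_nbrs_of_adj hy).fintype

theorem degree_squareLattice_le (x : ℤ × ℤ) : squareLattice.degree x ≤ 4 := by
  refine (Finset.card_le_card fun y hy => ?_).trans (card_nbrs_le x)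
  exact mem_nbrs_of_adj (by simpa using hy)

/-- Walks of `n + 1` steps are sorted by their first step. -/
theorem sum_finsetWalkLength_succ (n : ℕ) (u v : ℤ × ℤ) (F : squareLattice.Walk u v → ℝ) :
    ∑ p ∈ squareLattice.finsetWalkLength (n + 1) u v, F p
      = ∑ w : squareLattice.neighborSet u, ∑ p ∈ squareLattice.finsetWalkLength n w v,
          F (SimpleGraph.Walk.cons ((squareLattice.mem_neighborSet u w).1 w.2) p) := by
  rw [SimpleGraph.finsetWalkLength, Finset.sum_biUnion]
  · exact Finset.sum_congr rfl fun w _ => Finset.sum_map _ _ _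
  · intro w _ w' _ hne
    rw [Function.onFun, Finset.disjoint_left]
    intro p hp hp'
    obtain ⟨q, -, rfl⟩ := Finset.mem_map.1 hp
    obtain ⟨q', -, h⟩ := Finset.mem_map.1 hp'
    have h1 : (SimpleGraph.Walk.cons ((squareLattice.mem_neighborSet u w').1 w'.2) q').snd
        = (SimpleGraph.Walk.cons ((squareLattice.mem_neighborSet u w).1 w.2) q).snd :=
      congrArg SimpleGraph.Walk.snd h
    rw [SimpleGraph.Walk.snd_cons, SimpleGraph.Walk.snd_cons] at h1
    exact hne (Subtype.ext h1.symm)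

theorem card_finsetWalkLength_le (n : ℕ) (u v : ℤ × ℤ) :
    ((squareLattice.finsetWalkLength n u v).card : ℝ) ≤ 4 ^ n := by
  induction n generalizing u with
  | zero =>
    rw [SimpleGraph.finsetWalkLength]
    split_ifs with h
    · subst h; simp
    · simp
  | succ n ih =>
    have h := sum_finsetWalkLength_succ n u v fun _ => 1
    simp only [Finset.sum_const, nsmul_eq_mul, mul_one] at h
    rw [h]
    refine (Finset.sum_le_sum (g := fun _ => (4 : ℝ) ^ n)
      fun (w : squareLattice.neighborSet u) _ => ih w.1).trans ?_
    rw [Finset.sum_const, nsmul_eq_mul, pow_succ, mul_comm]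
    refine mul_le_mul_of_nonneg_left ?_ (by positivity)
    have := degree_squareLattice_le u
    rw [← SimpleGraph.card_neighborSet_eq_degree] at this
    exact_mod_cast this

/-- The product of the weights of the steps of a walk. -/
def pathWeight (a : ℤ × ℤ → ℤ × ℤ → ℝ) {x y : ℤ × ℤ} (p : squareLattice.Walk x y) : ℝ :=
  (p.darts.map fun d => a d.fst d.snd).prod

theorem pathWeight_cons (a : ℤ × ℤ → ℤ × ℤ → ℝ) {x y z : ℤ × ℤ} (h : squareLattice.Adj x y)
    (p : squareLattice.Walk y z) :
    pathWeight a (SimpleGraph.Walk.cons h p) = a x y * pathWeight a p := by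
  simp [pathWeight]

theorem abs_pathWeight_le {a : ℤ × ℤ → ℤ × ℤ → ℝ} {r : ℝ}
    (ha : ∀ x y, |a x y| ≤ r) {x y : ℤ × ℤ} (p : squareLattice.Walk x y) :
    |pathWeight a p| ≤ r ^ p.length := by
  have hr : 0 ≤ r := (abs_nonneg _).trans (ha 0 0)
  induction p with
  | nil => simp [pathWeight]
  | cons h p ih =>
    rw [pathWeight_cons, abs_mul, SimpleGraph.Walk.length_cons, pow_succ, mul_comm (r ^ _)]
    exact mul_le_mul (ha _ _) ih (abs_nonneg _) hr

section Trace

variable {ι : Type*} [Fintype ι] [DecidableEq ι]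

open Classical in
/-- The matrix of the weights of the steps between the sites `e i`. -/
noncomputable def stepMatrix (e : ι → ℤ × ℤ) (a : ℤ × ℤ → ℤ × ℤ → ℝ) : Matrix ι ι ℝ :=
  Matrix.of fun i j => if squareLattice.Adj (e i) (e j) then a (e i) (e j) else 0

theorem sum_pathWeight_eq_stepMatrix_pow {e : ι → ℤ × ℤ} (he : Function.Injective e)
    {a : ℤ × ℤ → ℤ × ℤ → ℝ} (ha : ∀ x y, a x y ≠ 0 → y ∈ Set.range e) (n : ℕ) (i j : ι) :
    ∑ p ∈ squareLattice.finsetWalkLength n (e i) (e j), pathWeight a p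
      = (stepMatrix e a ^ n) i j := by
  classical
  induction n generalizing i with
  | zero =>
    rw [SimpleGraph.finsetWalkLength, pow_zero, Matrix.one_apply]
    by_cases h : i = j
    · subst h; simp [pathWeight]
    · have h' : e i ≠ e j := fun h' => h (he h')
      simp [h, h']
  | succ n ih =>
    rw [sum_finsetWalkLength_succ, pow_succ', Matrix.mul_apply]
    simp_rw [pathWeight_cons, ← Finset.mul_sum]
    set f : ℤ × ℤ → ℝ := fun w => if squareLattice.Adj (e i) w then
      a (e i) w * ∑ p ∈ squareLattice.finsetWalkLength n w (e j), pathWeight a p else 0 with hf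
    have h1 : ∑ w : squareLattice.neighborSet (e i),
        a (e i) w * ∑ p ∈ squareLattice.finsetWalkLength n w (e j), pathWeight a p
        = ∑' w : ℤ × ℤ, f w := by
      rw [← tsum_fintype (L := .unconditional _),
        ← tsum_subtype_eq_of_support_subset (s := squareLattice.neighborSet (e i))]
      · refine tsum_congr fun w => ?_
        have : squareLattice.Adj (e i) w := w.2
        rw [hf]; simp only [this, if_true]
      · intro w hw
        by_contra h
        exact hw (if_neg h)
    have h2 : ∑ k, stepMatrix e a i k * (stepMatrix e a ^ n) k j = ∑' w : ℤ × ℤ, f w := by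
      rw [← he.tsum_eq, tsum_fintype]
      · refine Finset.sum_congr rfl fun k _ => ?_
        rw [hf]
        simp only [stepMatrix, Matrix.of_apply]
        split_ifs with h
        · rw [ih]; rfl
        · simp
      · intro w hw
        rw [Function.mem_support, hf] at hw
        refine ha (e i) w fun h => hw ?_
        simp [h]
    rw [h1, h2]

end Trace

/-- Loops of time `t`, weighted by `r ^ t` with `r < 1 / 4`, are summable if the distance of the
root to a fixed point is restricted to be at most `t + R`. -/
theorem summable_near_loops {r : ℝ≥0} (hr : 4 * r < 1) (R : ℕ) (z : ℤ × ℤ) :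
    Summable fun γ : Loop => if |γ.1.1 - z.1| ≤ γ.time + R ∧ |γ.1.2 - z.2| ≤ γ.time + R
      then (r : ℝ) ^ γ.time else 0 := by
  classical
  set g : ℤ × ℤ → ℕ → ℝ≥0 := fun v n =>
    if |v.1 - z.1| ≤ n + R ∧ |v.2 - z.2| ≤ n + R then r ^ n else 0 with hg
  have key : Summable fun γ : Loop => g γ.1 γ.time := by
    rw [← ENNReal.tsum_coe_ne_top_iff_summable]
    have h1 : ∀ v : ℤ × ℤ, ∑' p : {p : squareLattice.Walk v v // 0 < p.length},
        (g v p.1.length : ℝ≥0∞) ≤ ∑' n : ℕ, ((4 ^ n * g v n : ℝ≥0) : ℝ≥0∞) := by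
      intro v
      calc ∑' p : {p : squareLattice.Walk v v // 0 < p.length}, (g v p.1.length : ℝ≥0∞)
          ≤ ∑' p : squareLattice.Walk v v, (g v p.length : ℝ≥0∞) :=
            ENNReal.tsum_comp_le_tsum_of_injective Subtype.val_injective
              (fun p : squareLattice.Walk v v => (g v p.length : ℝ≥0∞))
        _ = ∑' n : ℕ, ∑' p : {p : squareLattice.Walk v v // p.length = n},
              (g v p.1.length : ℝ≥0∞) := by
            rw [← (Equiv.sigmaFiberEquiv
                (SimpleGraph.Walk.length (G := squareLattice) (u := v) (v := v))).tsum_eq,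
              ENNReal.tsum_sigma']
            rfl
        _ ≤ _ := by
            refine ENNReal.tsum_le_tsum fun n => ?_
            have : ∀ p : {p : squareLattice.Walk v v // p.length = n},
                (g v p.1.length : ℝ≥0∞) = g v n := fun p => by rw [p.2]
            simp_rw [this]
            rw [ENNReal.tsum_const, ENNReal.coe_mul]
            gcongr
            have hcard : ENat.card {p : squareLattice.Walk v v // p.length = n}
                = (squareLattice.finsetWalkLength n v v).card := by
              have : Fintype {p : squareLattice.Walk v v // p.length = n} :=
                SimpleGraph.fintypeSetWalkLength squareLattice v v n
              rw [ENat.card_eq_coe_fintype_card]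
              congr 1
              refine (Fintype.card_of_subtype _ fun p => ?_)
              exact SimpleGraph.mem_finsetWalkLength_iff
            rw [hcard]
            have := card_finsetWalkLength_le n v v
            have h' : (squareLattice.finsetWalkLength n v v).card ≤ 4 ^ n := by exact_mod_cast this
            have h'' : ((squareLattice.finsetWalkLength n v v).card : ℝ≥0∞) ≤ ((4 ^ n : ℕ) : ℝ≥0∞) :=
              Nat.cast_le.2 h'
            simpa using h''
    have h2 : ∀ n : ℕ, ∑' v : ℤ × ℤ, ((4 ^ n * g v n : ℝ≥0) : ℝ≥0∞)
        ≤ (((2 * (n + R) + 1) ^ 2 * (4 * r) ^ n : ℝ≥0) : ℝ≥0∞) := by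
      intro n
      set B : Finset (ℤ × ℤ) := Finset.Icc (z.1 - (n + R)) (z.1 + (n + R))
        ×ˢ Finset.Icc (z.2 - (n + R)) (z.2 + (n + R)) with hB
      have hcard : B.card = (2 * (n + R) + 1) ^ 2 := by
        rw [hB, Finset.card_product, Int.card_Icc, Int.card_Icc, sq]
        congr 1 <;> omega
      rw [tsum_eq_sum (s := B)]
      · refine (Finset.sum_le_card_nsmul B _ (((4 * r) ^ n : ℝ≥0) : ℝ≥0∞) fun v _ => ?_).trans ?_
        · rw [ENNReal.coe_le_coe, mul_pow]
          gcongr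
          rw [hg]
          dsimp only
          split_ifs
          · exact le_rfl
          · exact zero_le
        · rw [hcard, nsmul_eq_mul, ENNReal.coe_mul]
          push_cast
          exact le_rfl
      · intro v hv
        have : ¬(|v.1 - z.1| ≤ n + R ∧ |v.2 - z.2| ≤ n + R) := by
          intro h
          apply hv
          rw [abs_le, abs_le] at h
          rw [hB, Finset.mem_product, Finset.mem_Icc, Finset.mem_Icc]
          omega
        rw [hg]
        simp only [if_neg this, mul_zero, ENNReal.coe_zero]
    have h3 : Summable fun n : ℕ => ((2 * ((n : ℝ≥0) + R) + 1) ^ 2 * (4 * r) ^ n : ℝ≥0) := by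
      rw [← NNReal.summable_coe]
      have hlt : ‖(4 * r : ℝ)‖ < 1 := by
        rw [Real.norm_of_nonneg (by positivity)]; exact_mod_cast hr
      have s2 := summable_pow_mul_geometric_of_norm_lt_one 2 hlt
      have s1 := summable_pow_mul_geometric_of_norm_lt_one 1 hlt
      have s0 := summable_pow_mul_geometric_of_norm_lt_one 0 hlt
      refine (((s2.mul_left 4).add (s1.mul_left (8 * (R : ℝ) + 4))).add
        (s0.mul_left ((2 * (R : ℝ) + 1) ^ 2))).congr fun n => ?_
      push_cast
      ring
    refine ne_top_of_le_ne_top (ENNReal.tsum_coe_ne_top_iff_summable.2 h3) ?_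
    calc ∑' γ : Loop, (g γ.1 γ.time : ℝ≥0∞)
        = ∑' v : ℤ × ℤ, ∑' p : {p : squareLattice.Walk v v // 0 < p.length},
            (g v p.1.length : ℝ≥0∞) := ENNReal.tsum_sigma' _
      _ ≤ ∑' v : ℤ × ℤ, ∑' n : ℕ, ((4 ^ n * g v n : ℝ≥0) : ℝ≥0∞) := ENNReal.tsum_le_tsum h1
      _ = ∑' n : ℕ, ∑' v : ℤ × ℤ, ((4 ^ n * g v n : ℝ≥0) : ℝ≥0∞) := ENNReal.tsum_comm
      _ ≤ _ := ENNReal.tsum_le_tsum h2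
  refine (NNReal.summable_coe.2 key).congr fun γ => ?_
  rw [hg]
  dsimp only
  split_ifs <;> simp

/-- Loops sorted by their time, which is `t + 1` at index `t`. -/
def loopsByTime :
    (Σ t : ℕ, Σ v : ℤ × ℤ, {p : squareLattice.Walk v v // p.length = t + 1}) ≃ Loop where
  toFun x := ⟨x.2.1, x.2.2.1, by rw [x.2.2.2]; omega⟩
  invFun γ := ⟨γ.time - 1, γ.1, γ.2.1, (Nat.sub_add_cancel γ.2.2).symm⟩
  left_inv := by
    rintro ⟨t, v, p, hp⟩
    obtain rfl : t = p.length - 1 := by omega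
    rfl
  right_inv _ := rfl

theorem isHermitian_stepMatrix {ι : Type*} (e : ι → ℤ × ℤ) {a : ℤ × ℤ → ℤ × ℤ → ℝ}
    (hsymm : ∀ x y, a x y = a y x) : (stepMatrix e a).IsHermitian := by
  ext i j
  simp only [Matrix.conjTranspose_apply, stepMatrix, Matrix.of_apply, star_trivial]
  rw [hsymm (e j), squareLattice.adj_comm]

theorem row_sum_stepMatrix_le {ι : Type*} [Fintype ι] {e : ι → ℤ × ℤ}
    (he : Function.Injective e) {a : ℤ × ℤ → ℤ × ℤ → ℝ} {r : ℝ} (ha : ∀ x y, |a x y| ≤ r) (i : ι) :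
    ∑ j, |stepMatrix e a i j| ≤ 4 * r := by
  classical
  have hr : 0 ≤ r := (abs_nonneg _).trans (ha 0 0)
  have h1 : ∀ j, |stepMatrix e a i j| ≤ if e j ∈ nbrs (e i) then r else 0 := by
    intro j
    simp only [stepMatrix, Matrix.of_apply]
    by_cases h : squareLattice.Adj (e i) (e j)
    · rw [if_pos h, if_pos (mem_nbrs_of_adj h)]; exact ha _ _
    · rw [if_neg h, abs_zero]; split_ifs <;> simp [hr]
  refine (Finset.sum_le_sum fun j _ => h1 j).trans ?_
  rw [← Finset.sum_filter, Finset.sum_const, nsmul_eq_mul]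
  refine mul_le_mul_of_nonneg_right ?_ hr
  have h2 : (Finset.univ.filter fun j => e j ∈ nbrs (e i)).card ≤ (nbrs (e i)).card :=
    Finset.card_le_card_of_injOn e (fun j hj => by simpa using hj) he.injOn
  exact_mod_cast h2.trans (card_nbrs_le _)

/-- The loop expansion of a determinant: the loops in a finite box, weighted by the product of their
step weights and divided by their time, add up to `-log det (1 - A)` for the matrix `A` of step
weights. -/
theorem hasSum_pathWeight_div_time {ι : Type*} [Fintype ι] [DecidableEq ι]
    {e : ι → ℤ × ℤ} (he : Function.Injective e) {a : ℤ × ℤ → ℤ × ℤ → ℝ} {r : ℝ≥0} (hr : 4 * r < 1) (ha : ∀ x y, |a x y| ≤ r)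
    (hsymm : ∀ x y, a x y = a y x) (hsupp : ∀ x y, a x y ≠ 0 → y ∈ Set.range e) :
    HasSum (fun γ : Loop => pathWeight a γ.2.1 / γ.time)
      (-Real.log (1 - stepMatrix e a).det) := by
  classical
  have hsupp' : ∀ x, x ∉ Set.range e → ∀ y, a x y = 0 := fun x hx y => by
    by_contra h
    exact hx (hsupp y x (by rwa [hsymm]))
  have hzero : ∀ {x y : ℤ × ℤ} (p : squareLattice.Walk x y), x ∉ Set.range e → 0 < p.length →
      pathWeight a p = 0 := by
    intro x y p hx hp
    cases p with
    | nil => simp at hp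
    | cons h p => rw [pathWeight_cons, hsupp' x hx, zero_mul]
  have hsum : Summable fun γ : Loop => pathWeight a γ.2.1 / γ.time := by
    obtain ⟨R, hR⟩ : ∃ R : ℕ, ∀ i, |(e i).1| ≤ R ∧ |(e i).2| ≤ R := by
      refine ⟨∑ i, ((e i).1.natAbs + (e i).2.natAbs), fun i => ?_⟩
      have : (e i).1.natAbs + (e i).2.natAbs ≤ ∑ i, ((e i).1.natAbs + (e i).2.natAbs) :=
        Finset.single_le_sum (f := fun i => (e i).1.natAbs + (e i).2.natAbs)
          (fun i _ => Nat.zero_le _) (Finset.mem_univ i)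
      rw [Int.abs_eq_natAbs, Int.abs_eq_natAbs]
      omega
    refine Summable.of_norm_bounded (summable_near_loops hr R (0, 0)) fun γ => ?_
    have ht : 1 ≤ γ.time := γ.2.2
    by_cases hγ : γ.1 ∈ Set.range e
    · obtain ⟨i, hi⟩ := hγ
      have := hR i
      rw [hi] at this
      rw [if_pos (by simp only [sub_zero]; omega), norm_div, Real.norm_eq_abs, Real.norm_natCast]
      refine (div_le_self (abs_nonneg _) (by exact_mod_cast ht)).trans ?_
      exact abs_pathWeight_le ha _
    · rw [hzero _ hγ γ.2.2, zero_div, norm_zero]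
      split_ifs <;> positivity
  -- sorted by time, the loops of `t + 1` steps contribute `tr (A ^ (t + 1)) / (t + 1)`
  have h1 : HasSum (fun x => pathWeight a (loopsByTime x).2.1 / (loopsByTime x).time)
      (∑' γ : Loop, pathWeight a γ.2.1 / γ.time) :=
    (Equiv.hasSum_iff loopsByTime).2 hsum.hasSum
  have h2 : ∀ t : ℕ, HasSum (fun x : Σ v : ℤ × ℤ, {p : squareLattice.Walk v v // p.length = t + 1} =>
      pathWeight a (loopsByTime ⟨t, x⟩).2.1 / (loopsByTime ⟨t, x⟩).time)
      ((stepMatrix e a ^ (t + 1)).trace / (t + 1)) := by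
    intro t
    have hs := h1.summable.comp_injective (i := Sigma.mk t) sigma_mk_injective
    refine hs.hasSum_iff.2 ?_
    rw [hs.tsum_sigma]
    have h3 : ∀ v : ℤ × ℤ, ∑' p : {p : squareLattice.Walk v v // p.length = t + 1},
        pathWeight a (loopsByTime ⟨t, v, p⟩).2.1 / (loopsByTime ⟨t, v, p⟩).time
        = (∑ p ∈ squareLattice.finsetWalkLength (t + 1) v v, pathWeight a p) / (t + 1) := by
      intro v
      have : Fintype {p : squareLattice.Walk v v // p.length = t + 1} :=
        SimpleGraph.fintypeSetWalkLength squareLattice v v (t + 1)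
      rw [tsum_fintype, Finset.sum_div, Finset.sum_subtype
        (p := fun p : squareLattice.Walk v v => p.length = t + 1) _
        (fun p => SimpleGraph.mem_finsetWalkLength_iff)]
      refine Finset.sum_congr rfl fun p _ => ?_
      have : (loopsByTime ⟨t, v, p⟩).time = t + 1 := p.2
      rw [this]
      push_cast
      rfl
    simp only [Function.comp_apply, h3]
    rw [← he.tsum_eq, tsum_fintype]
    · simp_rw [sum_pathWeight_eq_stepMatrix_pow he hsupp, ← Finset.sum_div]
      rfl
    · intro v hv
      by_contra h
      refine hv ?_
      dsimp only
      rw [Finset.sum_eq_zero, zero_div]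
      intro p hp
      exact hzero p h (by rw [SimpleGraph.mem_finsetWalkLength_iff.1 hp]; omega)
  have h4 := h1.sigma h2
  have h5 := hasSum_trace_pow_div (isHermitian_stepMatrix e hsymm)
    (by exact_mod_cast hr : 4 * (r : ℝ) < 1) (row_sum_stepMatrix_le he ha)
  rw [← h4.unique h5]
  exact hsum.hasSum

end LoopSoup

/-! ### The Poisson soup of loops and its spin correlations -/

namespace LoopSoup

open scoped ENNReal
open Filter Topology

instance : DiscreteMeasurableSpace ℤˣ :=
  ⟨fun s => ⟨Units.val '' s, .of_discrete, Set.preimage_image_eq s Units.val_injective⟩⟩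

/-- A sign as a real number. -/
noncomputable def realSign : ℤˣ →* ℝ := (Int.castRingHom ℝ).toMonoidHom.comp (Units.coeHom ℤ)

@[simp] theorem realSign_neg_one : realSign (-1) = -1 := by simp [realSign]

theorem abs_realSign (u : ℤˣ) : |realSign u| = 1 := by
  rcases Int.units_eq_one_or u with rfl | rfl <;> simp

instance : Countable Loop := by
  have (t : ℕ) (v : ℤ × ℤ) : Countable {p : squareLattice.Walk v v // p.length = t + 1} :=
    have : Fintype {p : squareLattice.Walk v v // p.length = t + 1} :=
      SimpleGraph.fintypeSetWalkLength squareLattice v v (t + 1)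
    inferInstance
  exact Countable.of_equiv _ loopsByTime

instance (κ lam : ℝ≥0) : IsProbabilityMeasure (loopSoup κ lam) := by
  unfold loopSoup; infer_instance

/-- The weight of a single step under the massive loop measure. -/
noncomputable def stepMass (κ : ℝ≥0) : ℝ≥0 := 1 / (4 + κ)

theorem four_mul_stepMass_lt_one {κ : ℝ≥0} (hκ : 0 < κ) : 4 * stepMass κ < 1 := by
  rw [stepMass, mul_one_div, div_lt_one (by positivity)]
  exact lt_add_of_pos_right 4 hκ

theorem coe_massiveLoopMass (κ : ℝ≥0) (γ : Loop) :
    (massiveLoopMass κ γ : ℝ) = (stepMass κ : ℝ) ^ γ.time / γ.time := by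
  simp only [massiveLoopMass, stepMass]
  push_cast
  rw [one_div_pow]
  ring

theorem massiveLoopMass_le (κ : ℝ≥0) (γ : Loop) :
    (massiveLoopMass κ γ : ℝ) ≤ (stepMass κ : ℝ) ^ γ.time := by
  rw [coe_massiveLoopMass]
  exact div_le_self (by positivity) (by exact_mod_cast γ.2.2)

open Classical in
theorem summable_massiveLoopMass_winding {κ : ℝ≥0} (hκ : 0 < κ) (z : Face) :
    Summable fun γ : Loop => if windingNumber γ z ≠ 0 then (massiveLoopMass κ γ : ℝ) else 0 := by
  refine Summable.of_nonneg_of_le (fun γ => by positivity) (fun γ => ?_)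
    (summable_near_loops (four_mul_stepMass_lt_one hκ) 0 z)
  by_cases h : windingNumber γ z ≠ 0
  · have := abs_root_sub_le_time h
    rw [if_pos h, if_pos (by simpa using this)]
    exact massiveLoopMass_le κ γ
  · rw [if_neg h]
    split_ifs <;> positivity

theorem poissonMeasure_ne_zero_le (r : ℝ≥0) : poissonMeasure r {k | k ≠ 0} ≤ r := by
  have h : {k : ℕ | k ≠ 0} = {0}ᶜ := rfl
  rw [h, prob_compl_eq_one_sub (measurableSet_singleton 0), poissonMeasure_singleton]
  simp only [pow_zero, mul_one, Nat.factorial_zero, Nat.cast_one, div_one]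
  rw [← ENNReal.ofReal_one, ← ENNReal.ofReal_sub _ (Real.exp_nonneg _),
    ← ENNReal.ofReal_coe_nnreal]
  refine ENNReal.ofReal_le_ofReal ?_
  have := Real.add_one_le_exp (-(r : ℝ))
  linarith

theorem integral_poissonMeasure_realSign_pow (r : ℝ≥0) (u : ℤˣ) :
    ∫ k, realSign u ^ k ∂poissonMeasure r = Real.exp (r * (realSign u - 1)) := by
  rw [integral_poissonMeasure]
  have h : ∀ k : ℕ, (Real.exp (-r) * r ^ k / (k.factorial : ℝ)) • realSign u ^ k
      = Real.exp (-r) * ((r * realSign u) ^ k / (k.factorial : ℝ)) := fun k => by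
    rw [smul_eq_mul, mul_pow]; ring
  simp_rw [h]
  rw [tsum_mul_left, (NormedSpace.expSeries_div_hasSum_exp (r * realSign u)).tsum_eq,
    ← Real.exp_eq_exp_ℝ, ← Real.exp_add]
  congr 1
  ring

/-- By the Borel–Cantelli lemma. -/
theorem ae_finite_winding {κ : ℝ≥0} (hκ : 0 < κ) (lam : ℝ≥0) :
    ∀ᵐ ω ∂loopSoup κ lam, ∀ z : Face, {γ : Loop | ω γ ≠ 0 ∧ windingNumber γ z ≠ 0}.Finite := by
  classical
  rw [ae_all_iff]
  intro z
  refine ae_finite_setOfPred_mem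
    (s := fun γ : Loop => {ω : SoupConfig | ω γ ≠ 0 ∧ windingNumber γ z ≠ 0}) ?_
  have hs : Summable fun γ : Loop =>
      lam * (if windingNumber γ z ≠ 0 then massiveLoopMass κ γ else 0) := by
    refine Summable.mul_left _ ?_
    rw [← NNReal.summable_coe]
    refine (summable_massiveLoopMass_winding hκ z).congr fun γ => ?_
    split_ifs <;> rfl
  refine ne_top_of_le_ne_top (ENNReal.tsum_coe_ne_top_iff_summable.2 hs)
    (ENNReal.tsum_le_tsum fun γ => ?_)
  by_cases h : windingNumber γ z ≠ 0
  · rw [if_pos h]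
    have : {ω : SoupConfig | ω γ ≠ 0 ∧ windingNumber γ z ≠ 0}
        = (fun ω : SoupConfig => ω γ) ⁻¹' {k | k ≠ 0} := by
      ext ω; simp [h]
    rw [this, loopSoup, ← Measure.map_apply (measurable_pi_apply γ) .of_discrete,
      Measure.infinitePi_map_eval]
    exact poissonMeasure_ne_zero_le _
  · simp [h]

/-- The finite partial sums converge to the total winding on the measurable set of soups where only
finitely many terms are non-zero; off that set `totalWinding` takes the default value `0`. -/
theorem measurable_totalWinding (z : Face) : Measurable fun ω => totalWinding ω z := by
  set D : Set SoupConfig := {ω | (Function.support fun γ : Loop =>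
    (ω γ : ℤ) * windingNumber γ z).Finite} with hD
  have hterm : ∀ γ : Loop, Measurable fun ω : SoupConfig => (ω γ : ℤ) * windingNumber γ z :=
    fun γ => (Measurable.of_discrete (f := fun k : ℕ => (k : ℤ) * windingNumber γ z)).comp
      (measurable_pi_apply γ)
  have hDm : MeasurableSet D := by
    have : D = ⋃ S : Finset Loop, ⋂ γ : Loop, ⋂ _ : γ ∉ S,
        {ω | (ω γ : ℤ) * windingNumber γ z = 0} := by
      ext ω
      simp only [hD, Set.mem_ofPred_eq, Set.mem_iUnion, Set.mem_iInter]
      constructor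
      · intro h
        refine ⟨h.toFinset, fun γ hγ => ?_⟩
        rwa [Set.Finite.mem_toFinset, Function.notMem_support] at hγ
      · rintro ⟨S, hS⟩
        exact S.finite_toSet.subset fun γ hγ => by
          by_contra h
          exact hγ (hS γ h)
    rw [this]
    exact MeasurableSet.iUnion fun S => MeasurableSet.iInter fun γ => MeasurableSet.iInter fun _ =>
      hterm γ (measurableSet_singleton 0)
  refine measurable_of_tendsto_metrizable' (f := fun (S : Finset Loop) (ω : SoupConfig) =>
    D.indicator (fun ω => ∑ γ ∈ S, (ω γ : ℤ) * windingNumber γ z) ω) atTop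
    (fun S => (Finset.measurable_sum S fun γ _ => hterm γ).indicator hDm) ?_
  rw [tendsto_pi_nhds]
  intro ω
  by_cases hω : ω ∈ D
  · refine tendsto_const_nhds.congr' ?_
    filter_upwards [eventually_ge_atTop hω.toFinset] with S hS
    rw [Set.indicator_of_mem hω, totalWinding]
    exact finsum_eq_sum_of_support_subset _ (by
      intro γ hγ
      exact hS (hω.mem_toFinset.2 hγ))
  · have : totalWinding ω z = 0 := finsum_of_infinite_support hω
    simp only [Set.indicator_of_notMem hω, this]
    exact tendsto_const_nhds

theorem measurable_spinField (z : Face) : Measurable fun ω => spinField ω z :=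
  (Measurable.of_discrete (f := Int.negOnePow)).comp (measurable_totalWinding z)

theorem spinField_eq_prod {ω : SoupConfig} {z : Face} {S : Finset Loop}
    (hS : ∀ γ, ω γ ≠ 0 ∧ windingNumber γ z ≠ 0 → γ ∈ S) :
    spinField ω z = ∏ γ ∈ S, (windingNumber γ z).negOnePow ^ ω γ := by
  rw [spinField, totalWinding, finsum_eq_sum_of_support_subset (s := S)]
  · have hprod : ∀ (S : Finset Loop) (f : Loop → ℤ),
        (∑ γ ∈ S, f γ).negOnePow = ∏ γ ∈ S, (f γ).negOnePow := by
      classical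
      intro S f
      induction S using Finset.induction_on with
      | empty => simp
      | insert a s ha ih => rw [Finset.sum_insert ha, Finset.prod_insert ha, Int.negOnePow_add, ih]
    rw [hprod]
    refine Finset.prod_congr rfl fun γ _ => ?_
    rw [Int.negOnePow_def, mul_comm, zpow_mul, Int.negOnePow_def, zpow_natCast]
  · intro γ hγ
    refine hS γ ?_
    simpa using hγ

/-- The sign that a loop contributes to the product of the spins at the faces `z i`. -/
noncomputable def loopSign {ι : Type*} (s : Finset ι) (z : ι → Face) (γ : Loop) : ℤˣ :=
  ∏ i ∈ s, (windingNumber γ (z i)).negOnePow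

theorem summable_mass_mul_loopSign {κ : ℝ≥0} (hκ : 0 < κ) {ι : Type*} (s : Finset ι)
    (z : ι → Face) :
    Summable fun γ : Loop => (massiveLoopMass κ γ : ℝ) * (realSign (loopSign s z γ) - 1) := by
  classical
  refine Summable.of_norm_bounded (g := fun γ => ∑ i ∈ s, 2 *
    (if windingNumber γ (z i) ≠ 0 then (massiveLoopMass κ γ : ℝ) else 0))
    (summable_sum fun i _ => (summable_massiveLoopMass_winding hκ (z i)).mul_left 2) fun γ => ?_
  have hnn : ∀ i ∈ s, (0 : ℝ) ≤ 2 *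
      (if windingNumber γ (z i) ≠ 0 then (massiveLoopMass κ γ : ℝ) else 0) :=
    fun i _ => by positivity
  by_cases h : ∃ i ∈ s, windingNumber γ (z i) ≠ 0
  · obtain ⟨i, hi, hw⟩ := h
    refine le_trans ?_ (Finset.single_le_sum hnn hi)
    rw [if_pos hw, norm_mul, Real.norm_of_nonneg (NNReal.coe_nonneg _), mul_comm]
    refine mul_le_mul_of_nonneg_right ?_ (NNReal.coe_nonneg _)
    rcases Int.units_eq_one_or (loopSign s z γ) with h | h <;> rw [h] <;> norm_num
  · push Not at h
    have : loopSign s z γ = 1 := Finset.prod_eq_one fun i hi => by rw [h i hi]; simp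
    rw [this, map_one, sub_self, mul_zero, norm_zero]
    exact Finset.sum_nonneg hnn

/-- The correlations of the spin field, by the exponential formula for Poisson point processes. -/
theorem integral_prod_spinField {κ : ℝ≥0} (hκ : 0 < κ) (lam : ℝ≥0) {ι : Type*} (s : Finset ι)
    (z : ι → Face) :
    ∫ ω, ∏ i ∈ s, realSign (spinField ω (z i)) ∂loopSoup κ lam
      = Real.exp (∑' γ : Loop, lam *
          ((massiveLoopMass κ γ : ℝ) * (realSign (loopSign s z γ) - 1))) := by
  classical
  set F : Finset Loop → SoupConfig → ℝ := fun S ω => ∏ γ ∈ S, realSign (loopSign s z γ) ^ ω γ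
    with hF
  have hterm : ∀ γ : Loop, Measurable fun ω : SoupConfig => realSign (loopSign s z γ) ^ ω γ :=
    fun γ => (Measurable.of_discrete (f := fun k : ℕ => realSign (loopSign s z γ) ^ k)).comp
      (measurable_pi_apply γ)
  have hlim : Tendsto (fun S => ∫ ω, F S ω ∂loopSoup κ lam) atTop
      (𝓝 (∫ ω, ∏ i ∈ s, realSign (spinField ω (z i)) ∂loopSoup κ lam)) := by
    refine tendsto_integral_filter_of_dominated_convergence (fun _ => 1)
      (Eventually.of_forall fun S =>
        (Finset.measurable_prod S fun γ _ => hterm γ).aestronglyMeasurable)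
      (Eventually.of_forall fun S => ae_of_all _ fun ω => ?_) (integrable_const _) ?_
    · rw [hF, Real.norm_eq_abs, Finset.abs_prod]
      simp only [abs_pow, abs_realSign, one_pow, Finset.prod_const_one, le_refl]
    · filter_upwards [ae_finite_winding hκ lam] with ω hω
      refine tendsto_const_nhds.congr' ?_
      filter_upwards [eventually_ge_atTop (s.biUnion fun i => (hω (z i)).toFinset)] with S hS
      rw [hF]
      simp only [loopSign, ← map_pow, ← map_prod, ← Finset.prod_pow]
      rw [Finset.prod_comm]
      congr 1
      refine Finset.prod_congr rfl fun i hi => spinField_eq_prod fun γ hγ => hS ?_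
      exact Finset.mem_biUnion.2 ⟨i, hi, (hω (z i)).mem_toFinset.2 hγ⟩
  have hval : ∀ S, ∫ ω, F S ω ∂loopSoup κ lam = Real.exp (∑ γ ∈ S, lam *
      ((massiveLoopMass κ γ : ℝ) * (realSign (loopSign s z γ) - 1))) := by
    intro S
    have h1 : ∀ ω : SoupConfig, F S ω
        = (fun y : S → ℕ => ∏ γ : S, realSign (loopSign s z γ) ^ y γ) (S.restrict ω) := by
      intro ω
      rw [hF]
      simp only [Finset.restrict]
      exact (Finset.prod_coe_sort S fun γ => realSign (loopSign s z γ) ^ ω γ).symm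
    have h2 := integral_restrict_infinitePi
      (fun γ : Loop => poissonMeasure (lam * massiveLoopMass κ γ)) (s := S)
      (f := fun y : S → ℕ => ∏ γ : S, realSign (loopSign s z γ) ^ y γ)
      Measurable.of_discrete.aestronglyMeasurable
    rw [integral_congr_ae (ae_of_all _ h1), loopSoup]
    refine h2.trans ?_
    rw [integral_fintype_prod_eq_prod (fun (γ : S) (k : ℕ) => realSign (loopSign s z γ) ^ k)]
    simp_rw [integral_poissonMeasure_realSign_pow]
    rw [← Real.exp_sum, ← Finset.sum_coe_sort S]
    congr 1
    refine Finset.sum_congr rfl fun γ _ => ?_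
    push_cast
    ring
  simp_rw [hval] at hlim
  refine tendsto_nhds_unique hlim ((Real.continuous_exp.tendsto _).comp ?_)
  exact ((summable_mass_mul_loopSign hκ s z).mul_left (lam : ℝ)).hasSum

namespace IsReflection

variable {ϑ : ℤ × ℤ → ℤ × ℤ} {θ : Face → Face}

/-- The reflection of a soup: every loop is replaced by its mirror image. -/
def soupEquiv (hr : IsReflection ϑ θ) (ω : SoupConfig) : SoupConfig := fun γ => ω (hr.loopEquiv γ)

theorem loopEquiv_loopEquiv (hr : IsReflection ϑ θ) (γ : Loop) :
    hr.loopEquiv (hr.loopEquiv γ) = γ := hr.loopEquiv.left_inv γ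

theorem measurePreserving_soupEquiv (hr : IsReflection ϑ θ) (κ lam : ℝ≥0) :
    MeasurePreserving hr.soupEquiv (loopSoup κ lam) (loopSoup κ lam) := by
  refine ⟨measurable_pi_lambda _ fun γ => measurable_pi_apply _, ?_⟩
  have h := Measure.infinitePi_map_piCongrLeft
    (μ := fun γ : Loop => poissonMeasure (lam * massiveLoopMass κ γ)) hr.loopEquiv
  have h1 : (fun γ : Loop => poissonMeasure (lam * massiveLoopMass κ (hr.loopEquiv γ)))
      = fun γ => poissonMeasure (lam * massiveLoopMass κ γ) := by
    ext γ : 1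
    rw [massiveLoopMass, massiveLoopMass, hr.time_loopEquiv]
  rw [h1] at h
  rw [loopSoup]
  convert h using 2
  ext ω γ
  obtain ⟨γ', rfl⟩ := hr.loopEquiv.surjective γ
  rw [MeasurableEquiv.coe_piCongrLeft, Equiv.piCongrLeft_apply_apply, soupEquiv,
    hr.loopEquiv_loopEquiv]

/-- The spins of the reflected soup are the reflected spins, as a sign does not matter modulo `2`. -/
theorem spinField_soupEquiv (hr : IsReflection ϑ θ) (ω : SoupConfig) :
    spinField (hr.soupEquiv ω) = spinField ω ∘ θ := by
  ext z : 1
  have : totalWinding (hr.soupEquiv ω) z = -totalWinding ω (θ z) := by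
    rw [totalWinding, totalWinding, ← finsum_neg_distrib,
      ← finsum_comp_equiv hr.loopEquiv (f := fun γ => -((ω γ : ℤ) * windingNumber γ (θ z)))]
    refine finsum_congr fun γ => ?_
    rw [hr.windingNumber_loopEquiv, soupEquiv]
    ring
  rw [Function.comp_apply, spinField, spinField, this, Int.negOnePow_neg]

end IsReflection

end LoopSoup

/-! ### Reflection positivity of the correlations -/

namespace LoopSoup

open Filter Topology Matrix

/-- A lattice reflection, together with the data in which its geometry enters: a half `H` of the
faces, a direction `d` of rays that stay in that half, and the (rescaled) signed distance `h` of a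
vertex to the line of reflection. An edge that crosses the line joins a vertex to its mirror image,
and no edge runs inside the line. -/
structure MirrorGeometry (ϑ : ℤ × ℤ → ℤ × ℤ) (θ : Face → Face) (H : Set Face) (d : ℤ × ℤ)
    (h : ℤ × ℤ → ℤ) : Prop extends IsReflection ϑ θ where
  isDirection : IsDirection d
  height_reflect : ∀ v, h (ϑ v) = -h v
  reflect_of_height_eq_zero : ∀ v, h v = 0 → ϑ v = v
  nonneg_of_crossesRay : ∀ z ∈ H, ∀ x y, squareLattice.Adj x y → CrossesRay d z x y →
    0 ≤ h x ∧ 0 ≤ h y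
  height_ne_zero_of_adj : ∀ x y, squareLattice.Adj x y → h x = 0 → h y ≠ 0
  eq_reflect_of_adj : ∀ x y, squareLattice.Adj x y → 0 < h x → h y < 0 → y = ϑ x

/-- The product of the ray signs of the faces in `A`. -/
def cutSign (d : ℤ × ℤ) (A : Finset Face) (x y : ℤ × ℤ) : ℤˣ := ∏ z ∈ A, raySign d z x y

theorem cutSign_comm (d : ℤ × ℤ) (A : Finset Face) (x y : ℤ × ℤ) :
    cutSign d A x y = cutSign d A y x :=
  Finset.prod_congr rfl fun z _ => raySign_comm d z x y

theorem pathWeight_realSign_prod {x y : ℤ × ℤ} (p : squareLattice.Walk x y) (r : ℝ)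
    (f : ℤ × ℤ → ℤ × ℤ → ℤˣ) :
    pathWeight (fun x y => r * realSign (f x y)) p
      = r ^ p.length * realSign (p.darts.map fun e => f e.fst e.snd).prod := by
  induction p with
  | nil => simp [pathWeight]
  | cons h p ih =>
    rw [pathWeight_cons, ih]
    simp only [SimpleGraph.Walk.length_cons, SimpleGraph.Walk.darts_cons, List.map_cons,
      List.prod_cons, map_mul, pow_succ]
    ring

open Classical in
/-- The restriction of the weights of the steps to a set of vertices. -/
noncomputable def restrictWeight (R : Set (ℤ × ℤ)) (a : ℤ × ℤ → ℤ × ℤ → ℝ) (x y : ℤ × ℤ) : ℝ :=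
  if x ∈ R ∧ y ∈ R then a x y else 0

theorem restrictWeight_comm (R : Set (ℤ × ℤ)) {a : ℤ × ℤ → ℤ × ℤ → ℝ}
    (ha : ∀ x y, a x y = a y x) (x y : ℤ × ℤ) : restrictWeight R a x y = restrictWeight R a y x := by
  classical exact if_congr and_comm (ha x y) rfl

open Classical in
/-- Restricting the weights of the steps to a set of vertices restricts the sum over loops to the
loops in that set. -/
theorem pathWeight_restrict (R : Set (ℤ × ℤ)) (a : ℤ × ℤ → ℤ × ℤ → ℝ) {x y : ℤ × ℤ}
    (p : squareLattice.Walk x y) (hp : 0 < p.length) :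
    pathWeight (restrictWeight R a) p
      = if ∀ v ∈ p.support, v ∈ R then pathWeight a p else 0 := by
  have key : ∀ {x y : ℤ × ℤ} (p : squareLattice.Walk x y),
      (if x ∈ R then pathWeight (restrictWeight R a) p else 0)
        = if ∀ v ∈ p.support, v ∈ R then pathWeight a p else 0 := by
    intro x y p
    induction p with
    | nil => simp [pathWeight]
    | @cons u v w h p ih =>
      rw [pathWeight_cons, pathWeight_cons]
      simp only [SimpleGraph.Walk.support_cons, List.mem_cons, forall_eq_or_imp]
      by_cases hu : u ∈ R
      · by_cases hv : v ∈ R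
        · rw [if_pos hv] at ih
          simp only [restrictWeight, hu, hv, and_self, if_true, true_and]
          rw [ih]
          simp only [mul_ite, mul_zero]
        · have hns : ¬(u ∈ R ∧ ∀ w ∈ p.support, w ∈ R) :=
            fun h' => hv (h'.2 v p.start_mem_support)
          have hr : restrictWeight R a u v = 0 := if_neg fun h' => hv h'.2
          rw [if_neg hns, hr, zero_mul, ite_self]
      · rw [if_neg hu, if_neg fun h' => hu h'.1]
  rw [← key p]
  by_cases hx : x ∈ R
  · rw [if_pos hx]
  · rw [if_neg hx]
    cases p with
    | nil => simp at hp
    | cons h p => rw [pathWeight_cons, restrictWeight, if_neg fun h' => hx h'.1, zero_mul]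

namespace MirrorGeometry

variable {ϑ : ℤ × ℤ → ℤ × ℤ} {θ : Face → Face} {H : Set Face} {d : ℤ × ℤ} {h : ℤ × ℤ → ℤ}

/-- The sign of an edge under the twist by the faces in `A` and the mirror images of those in `B`:
the cuts of the latter are the mirror images of rays in the direction `d`. -/
def twist (ϑ : ℤ × ℤ → ℤ × ℤ) (d : ℤ × ℤ) (A B : Finset Face) (x y : ℤ × ℤ) : ℤˣ :=
  cutSign d A x y * cutSign d B (ϑ x) (ϑ y)

/-- The sign of a loop in the correlation of the spins in `A` and the mirror images of those in `B` is
the product of the twists of its edges. -/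
theorem loopSign_eq_prod_twist (hg : MirrorGeometry ϑ θ H d h) (A B : Finset Face) (γ : Loop) :
    loopSign (A.disjSum B) (Sum.elim id θ) γ
      = (γ.2.1.darts.map fun e => twist ϑ d A B e.fst e.snd).prod := by
  have hcut : ∀ A : Finset Face, ∀ γ : Loop, ∏ z ∈ A, (windingNumber γ z).negOnePow
      = (γ.2.1.darts.map fun e => cutSign d A e.fst e.snd).prod := by
    intro A γ
    have h1 : ∀ z ∈ A, (windingNumber γ z).negOnePow
        = (γ.2.1.darts.map fun e => raySign d z e.fst e.snd).prod :=
      fun z _ => (windingNumber_ray hg.isDirection γ z).1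
    rw [Finset.prod_congr rfl h1]
    simp only [cutSign]
    induction γ.2.1.darts with
    | nil => simp
    | cons e l ih => simp only [List.map_cons, List.prod_cons, Finset.prod_mul_distrib, ih]
  have hB : ∏ z ∈ B, (windingNumber γ (θ z)).negOnePow
      = (γ.2.1.darts.map fun e => cutSign d B (ϑ e.fst) (ϑ e.snd)).prod := by
    have h1 : ∀ z ∈ B, (windingNumber γ (θ z)).negOnePow
        = (windingNumber (hg.loopEquiv γ) z).negOnePow := fun z _ => by
      have := hg.windingNumber_loopEquiv γ (θ z)
      rw [hg.face_involutive z] at this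
      rw [this, Int.negOnePow_neg]
    rw [Finset.prod_congr rfl h1, hcut]
    have h2 : (hg.loopEquiv γ).2.1.darts = γ.2.1.darts.map hg.hom.mapDart :=
      SimpleGraph.Walk.darts_map hg.hom γ.2.1
    rw [h2, List.map_map]
    rfl
  rw [loopSign, Finset.prod_disjSum]
  simp only [Sum.elim_inl, Sum.elim_inr, id]
  rw [hcut A γ, hB, ← List.prod_map_mul]
  rfl

/-- The cuts of faces in `H` stay on the positive side of the line. -/
theorem cutSign_eq_one (hg : MirrorGeometry ϑ θ H d h) {A : Finset Face} (hA : ↑A ⊆ H)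
    {x y : ℤ × ℤ} (hxy : squareLattice.Adj x y) (hneg : h x < 0 ∨ h y < 0) :
    cutSign d A x y = 1 := by
  refine Finset.prod_eq_one fun z hz => if_neg fun hc => ?_
  have := hg.nonneg_of_crossesRay z (hA hz) x y hxy hc
  omega

/-- The sites of a finite box: those on the positive side of the line, their mirror images, and
those on the line. -/
def site (ϑ : ℤ × ℤ → ℤ × ℤ) (h : ℤ × ℤ → ℤ) (F : Finset (ℤ × ℤ)) :
    ({v // v ∈ F.filter fun v => 0 < h v} ⊕ {v // v ∈ F.filter fun v => 0 < h v})
      ⊕ {v // v ∈ F.filter fun v => h v = 0} → ℤ × ℤ :=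
  Sum.elim (Sum.elim (fun v => v.1) fun v => ϑ v.1) fun v => v.1

theorem site_injective (hg : MirrorGeometry ϑ θ H d h) (F : Finset (ℤ × ℤ)) :
    Function.Injective (site ϑ h F) := by
  have hpos : ∀ v : {v // v ∈ F.filter fun v => 0 < h v}, 0 < h v.1 :=
    fun v => (Finset.mem_filter.1 v.2).2
  have hzero : ∀ v : {v // v ∈ F.filter fun v => h v = 0}, h v.1 = 0 :=
    fun v => (Finset.mem_filter.1 v.2).2
  have hneg : ∀ v : {v // v ∈ F.filter fun v => 0 < h v}, h (ϑ v.1) < 0 := fun v => by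
    rw [hg.height_reflect]; have := hpos v; omega
  rintro ((x | x) | x) ((y | y) | y) hxy <;> simp only [site, Sum.elim_inl, Sum.elim_inr] at hxy
  · rw [Subtype.ext hxy]
  · have := hpos x; have := hneg y; rw [hxy] at *; omega
  · have := hpos x; have := hzero y; rw [hxy] at *; omega
  · have := hneg x; have := hpos y; rw [hxy] at *; omega
  · rw [Subtype.ext (hg.vertex_involutive.injective hxy)]
  · have := hneg x; have := hzero y; rw [hxy] at *; omega
  · have := hzero x; have := hpos y; rw [hxy] at *; omega
  · have := hzero x; have := hneg y; rw [hxy] at *; omega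
  · rw [Subtype.ext hxy]

theorem mem_range_site (hg : MirrorGeometry ϑ θ H d h) {F : Finset (ℤ × ℤ)} {v : ℤ × ℤ}
    (h1 : v ∈ F) (h2 : ϑ v ∈ F) : v ∈ Set.range (site ϑ h F) := by
  rcases lt_trichotomy (h v) 0 with hv | hv | hv
  · refine ⟨Sum.inl (Sum.inr ⟨ϑ v, Finset.mem_filter.2 ⟨h2, ?_⟩⟩), hg.vertex_involutive v⟩
    rw [hg.height_reflect]; omega
  · exact ⟨Sum.inr ⟨v, Finset.mem_filter.2 ⟨h1, hv⟩⟩, rfl⟩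
  · exact ⟨Sum.inl (Sum.inl ⟨v, Finset.mem_filter.2 ⟨h1, hv⟩⟩), rfl⟩

/-- The weight of a step in a finite box, twisted by the faces in `A` and the mirror images of
those in `B`. -/
noncomputable def boxWeight (ϑ : ℤ × ℤ → ℤ × ℤ) (h : ℤ × ℤ → ℤ) (d : ℤ × ℤ) (κ : ℝ≥0)
    (F : Finset (ℤ × ℤ)) (A B : Finset Face) : ℤ × ℤ → ℤ × ℤ → ℝ :=
  restrictWeight (Set.range (site ϑ h F)) fun x y => stepMass κ * realSign (twist ϑ d A B x y)

theorem abs_boxWeight_le (κ : ℝ≥0) (F : Finset (ℤ × ℤ)) (A B : Finset Face) (x y : ℤ × ℤ) :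
    |boxWeight ϑ h d κ F A B x y| ≤ stepMass κ := by
  unfold boxWeight restrictWeight
  split_ifs
  · rw [abs_mul, abs_realSign, mul_one, NNReal.abs_eq]
  · simp

theorem boxWeight_comm (κ : ℝ≥0) (F : Finset (ℤ × ℤ)) (A B : Finset Face) (x y : ℤ × ℤ) :
    boxWeight ϑ h d κ F A B x y = boxWeight ϑ h d κ F A B y x := by
  refine restrictWeight_comm _ (fun x y => ?_) x y
  rw [twist, twist, cutSign_comm d A, cutSign_comm d B]

theorem mem_range_of_boxWeight_ne_zero (κ : ℝ≥0) (F : Finset (ℤ × ℤ)) (A B : Finset Face)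
    (x y : ℤ × ℤ) (hne : boxWeight ϑ h d κ F A B x y ≠ 0) : y ∈ Set.range (site ϑ h F) := by
  by_contra hy
  exact hne (if_neg fun hc => hy hc.2)

open Classical in
/-- The weight `u * stepMass κ` on the edges of the lattice. -/
noncomputable def edgeWeight (κ : ℝ≥0) (u : ℤˣ) (x y : ℤ × ℤ) : ℝ :=
  if squareLattice.Adj x y then stepMass κ * realSign u else 0

theorem edgeWeight_of_not_adj {κ : ℝ≥0} {u : ℤˣ} {x y : ℤ × ℤ} (hxy : ¬squareLattice.Adj x y) :
    edgeWeight κ u x y = 0 := if_neg hxy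

theorem edgeWeight_congr {κ : ℝ≥0} {u u' : ℤˣ} {x y x' y' : ℤ × ℤ}
    (hadj : squareLattice.Adj x y ↔ squareLattice.Adj x' y')
    (hu : squareLattice.Adj x' y' → u = u') : edgeWeight κ u x y = edgeWeight κ u' x' y' := by
  unfold edgeWeight
  by_cases hxy : squareLattice.Adj x' y'
  · rw [if_pos hxy, if_pos (hadj.2 hxy), hu hxy]
  · rw [if_neg hxy, if_neg fun h' => hxy (hadj.1 h')]

/-- The coupling of a vertex to its mirror image. -/
noncomputable def mirrorCoupling (ϑ : ℤ × ℤ → ℤ × ℤ) (h : ℤ × ℤ → ℤ) (κ : ℝ≥0)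
    (F : Finset (ℤ × ℤ)) (x : {v // v ∈ F.filter fun v => 0 < h v}) : ℝ :=
  edgeWeight κ 1 x.1 (ϑ x.1)

/-- The quadratic form of the field on one side of the line, with twisted steps. -/
noncomputable def sideBlock (h : ℤ × ℤ → ℤ) (d : ℤ × ℤ) (κ : ℝ≥0) (F : Finset (ℤ × ℤ))
    (A : Finset Face) : Matrix {v // v ∈ F.filter fun v => 0 < h v}
      {v // v ∈ F.filter fun v => 0 < h v} ℝ :=
  1 - Matrix.of fun x y => edgeWeight κ (cutSign d A x.1 y.1) x.1 y.1

/-- The coupling of the field on one side of the line to the field on the line. -/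
noncomputable def lineBlock (h : ℤ × ℤ → ℤ) (d : ℤ × ℤ) (κ : ℝ≥0) (F : Finset (ℤ × ℤ))
    (A : Finset Face) : Matrix {v // v ∈ F.filter fun v => 0 < h v}
      {v // v ∈ F.filter fun v => h v = 0} ℝ :=
  Matrix.of fun x y => -edgeWeight κ (cutSign d A x.1 y.1) x.1 y.1

theorem stepMatrix_boxWeight (κ : ℝ≥0) (F : Finset (ℤ × ℤ)) (A B : Finset Face) (i j) :
    stepMatrix (site ϑ h F) (boxWeight ϑ h d κ F A B) i j
      = edgeWeight κ (twist ϑ d A B (site ϑ h F i) (site ϑ h F j)) (site ϑ h F i)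
          (site ϑ h F j) := by
  simp only [stepMatrix, of_apply, boxWeight, restrictWeight, Set.mem_range_self, and_self,
    if_true, edgeWeight]

/-- The twist by `A` only affects the positive side and the twist by `B` only the negative side,
and neither affects the coupling of the two sides. -/
theorem one_sub_stepMatrix_eq_mirrorBlock (hg : MirrorGeometry ϑ θ H d h) (κ : ℝ≥0)
    (F : Finset (ℤ × ℤ)) {A B : Finset Face} (hA : ↑A ⊆ H) (hB : ↑B ⊆ H) :
    1 - stepMatrix (site ϑ h F) (boxWeight ϑ h d κ F A B)
      = mirrorBlock (mirrorCoupling ϑ h κ F)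
          (sideBlock h d κ F A) (sideBlock h d κ F B) (lineBlock h d κ F A)
          (lineBlock h d κ F B) := by
  have hpos : ∀ v : {v // v ∈ F.filter fun v => 0 < h v}, 0 < h v.1 :=
    fun v => (Finset.mem_filter.1 v.2).2
  have hzero : ∀ v : {v // v ∈ F.filter fun v => h v = 0}, h v.1 = 0 :=
    fun v => (Finset.mem_filter.1 v.2).2
  have hneg : ∀ v : {v // v ∈ F.filter fun v => 0 < h v}, h (ϑ v.1) < 0 := fun v => by
    rw [hg.height_reflect]; have := hpos v; omega
  have hadj : ∀ x y, squareLattice.Adj (ϑ x) (ϑ y) ↔ squareLattice.Adj x y := fun x y =>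
    ⟨fun hxy => by simpa only [hg.vertex_involutive _] using hg.adj _ _ hxy, hg.adj x y⟩
  have htA : ∀ x y, squareLattice.Adj x y → 0 < h x → twist ϑ d A B x y = cutSign d A x y := by
    intro x y hxy hx
    rw [twist, hg.cutSign_eq_one hB ((hadj x y).2 hxy)
      (Or.inl (by rw [hg.height_reflect]; omega)), mul_one]
  have htB : ∀ x y, squareLattice.Adj x y → 0 < h x →
      twist ϑ d A B (ϑ x) (ϑ y) = cutSign d B x y := by
    intro x y hxy hx
    rw [twist, hg.cutSign_eq_one hA ((hadj x y).2 hxy)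
      (Or.inl (by rw [hg.height_reflect]; omega)), one_mul, hg.vertex_involutive,
      hg.vertex_involutive]
  have hline : ∀ i (t : {v // v ∈ F.filter fun v => h v = 0}),
      (1 - stepMatrix (site ϑ h F) (boxWeight ϑ h d κ F A B)) (Sum.inl i) (Sum.inr t)
      = (fromRows (lineBlock h d κ F A) (lineBlock h d κ F B)) i t := by
    intro i t
    rw [Matrix.sub_apply, one_apply_ne (by simp), stepMatrix_boxWeight, zero_sub]
    rcases i with x | x
    · exact congrArg Neg.neg (edgeWeight_congr Iff.rfl fun hxt => htA _ _ hxt (hpos x))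
    · have ht := hg.reflect_of_height_eq_zero _ (hzero t)
      have h1 := hadj x.1 t.1
      rw [ht] at h1
      refine congrArg Neg.neg (edgeWeight_congr h1 fun hxt => ?_)
      have h2 := htB _ _ hxt (hpos x)
      rwa [ht] at h2
  have hcross : ∀ x y : {v // v ∈ F.filter fun v => 0 < h v},
      (1 - stepMatrix (site ϑ h F) (boxWeight ϑ h d κ F A B)) (Sum.inl (Sum.inl x))
        (Sum.inl (Sum.inr y)) = (-diagonal (mirrorCoupling ϑ h κ F)) x y := by
    intro x y
    rw [Matrix.sub_apply, one_apply_ne (by simp), stepMatrix_boxWeight, Matrix.neg_apply, zero_sub]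
    congr 1
    change edgeWeight κ (twist ϑ d A B x.1 (ϑ y.1)) x.1 (ϑ y.1) = _
    by_cases hxy : squareLattice.Adj x.1 (ϑ y.1)
    · obtain rfl : y = x := Subtype.ext (hg.vertex_involutive.injective
        (hg.eq_reflect_of_adj _ _ hxy (hpos x) (hneg y)))
      rw [diagonal_apply_eq, htA _ _ hxy (hpos y), hg.cutSign_eq_one hA hxy (Or.inr (hneg y))]
      rfl
    · rw [edgeWeight_of_not_adj hxy]
      by_cases h1 : x = y
      · subst h1
        rw [diagonal_apply_eq]
        exact (edgeWeight_of_not_adj hxy).symm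
      · rw [diagonal_apply_ne _ h1]
  have hsymm : ∀ i j, (1 - stepMatrix (site ϑ h F) (boxWeight ϑ h d κ F A B)) i j
      = (1 - stepMatrix (site ϑ h F) (boxWeight ϑ h d κ F A B)) j i := fun i j => by
    have h1 := isHermitian_one.sub (isHermitian_stepMatrix (site ϑ h F)
      (boxWeight_comm (ϑ := ϑ) (h := h) (d := d) κ F A B))
    simpa using h1.apply j i
  ext ((x | x) | x) ((y | y) | y)
  · rw [Matrix.sub_apply, stepMatrix_boxWeight]
    change _ = (1 : Matrix _ _ ℝ) x y - edgeWeight κ (cutSign d A x.1 y.1) x.1 y.1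
    congr 1
    · simp only [one_apply, Sum.inl.injEq]
    · exact edgeWeight_congr Iff.rfl fun hxy => htA _ _ hxy (hpos x)
  · exact hcross x y
  · exact hline (Sum.inl x) y
  · rw [hsymm, hcross]
    change (-diagonal (mirrorCoupling ϑ h κ F)) y x = (-diagonal (mirrorCoupling ϑ h κ F)) x y
    rw [Matrix.neg_apply, Matrix.neg_apply, ← transpose_apply (diagonal _) x y,
      diagonal_transpose]
  · rw [Matrix.sub_apply, stepMatrix_boxWeight]
    change _ = (1 : Matrix _ _ ℝ) x y - edgeWeight κ (cutSign d B x.1 y.1) x.1 y.1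
    congr 1
    · simp only [one_apply, Sum.inl.injEq, Sum.inr.injEq]
    · exact edgeWeight_congr (hadj _ _) fun hxy => htB _ _ hxy (hpos x)
  · exact hline (Sum.inr x) y
  · rw [hsymm, hline]
    rfl
  · rw [hsymm, hline]
    rfl
  · have h0 : edgeWeight κ (twist ϑ d A B x.1 y.1) x.1 y.1 = 0 := edgeWeight_of_not_adj fun hxy =>
      hg.height_ne_zero_of_adj _ _ hxy (hzero x) (hzero y)
    rw [Matrix.sub_apply, stepMatrix_boxWeight]
    change _ - edgeWeight κ (twist ϑ d A B x.1 y.1) x.1 y.1 = (1 : Matrix _ _ ℝ) x y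
    rw [h0, sub_zero]
    simp only [one_apply, Sum.inr.injEq]

open Classical in
/-- The loops in a finite box, weighted by the twist. -/
theorem hasSum_box_loops (hg : MirrorGeometry ϑ θ H d h) {κ : ℝ≥0} (hκ : 0 < κ)
    (F : Finset (ℤ × ℤ)) (A B : Finset Face) :
    HasSum (fun γ : Loop => if ∀ v ∈ γ.2.1.support, v ∈ Set.range (site ϑ h F) then
        (massiveLoopMass κ γ : ℝ) * realSign (loopSign (A.disjSum B) (Sum.elim id θ) γ) else 0)
      (-Real.log (1 - stepMatrix (site ϑ h F) (boxWeight ϑ h d κ F A B)).det) := by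
  have h1 := hasSum_pathWeight_div_time (hg.site_injective F) (four_mul_stepMass_lt_one hκ)
    (abs_boxWeight_le (ϑ := ϑ) (h := h) (d := d) κ F A B) (boxWeight_comm κ F A B)
    (mem_range_of_boxWeight_ne_zero κ F A B)
  convert h1 using 2 with γ
  have h2 := pathWeight_restrict (Set.range (site ϑ h F))
    (fun x y => stepMass κ * realSign (twist ϑ d A B x y)) γ.2.1 γ.2.2
  rw [boxWeight, h2]
  by_cases hc : ∀ v ∈ γ.2.1.support, v ∈ Set.range (site ϑ h F)
  · rw [if_pos hc, if_pos hc, pathWeight_realSign_prod, ← hg.loopSign_eq_prod_twist,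
      coe_massiveLoopMass, Loop.time]
    ring
  · rw [if_neg hc, if_neg hc, zero_div]

theorem posDef_one_sub_box (hg : MirrorGeometry ϑ θ H d h) {κ : ℝ≥0} (hκ : 0 < κ)
    (F : Finset (ℤ × ℤ)) (A B : Finset Face) :
    (1 - stepMatrix (site ϑ h F) (boxWeight ϑ h d κ F A B)).PosDef :=
  posDef_one_sub_of_row_sum_le (isHermitian_stepMatrix _ (boxWeight_comm κ F A B))
    (by exact_mod_cast four_mul_stepMass_lt_one hκ : 4 * (stepMass κ : ℝ) < 1)
    (row_sum_stepMatrix_le (hg.site_injective F) (abs_boxWeight_le κ F A B))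

open Classical in
/-- In a finite box the correlations of the spins at intensity `1 / 2` are ratios of partition
functions of Gaussian fields. -/
theorem exp_box_eq (hg : MirrorGeometry ϑ θ H d h) {κ : ℝ≥0} (hκ : 0 < κ)
    (F : Finset (ℤ × ℤ)) (A B : Finset Face) :
    Real.exp (∑' γ : Loop, (1 / 2 : ℝ) *
      (if ∀ v ∈ γ.2.1.support, v ∈ Set.range (site ϑ h F) then (massiveLoopMass κ γ : ℝ)
        * (realSign (loopSign (A.disjSum B) (Sum.elim id θ) γ) - 1) else 0))
      = √(1 - stepMatrix (site ϑ h F) (boxWeight ϑ h d κ F ∅ ∅)).det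
        * (√(1 - stepMatrix (site ϑ h F) (boxWeight ϑ h d κ F A B)).det)⁻¹ := by
  have h0 := (hg.posDef_one_sub_box hκ F ∅ ∅).det_pos
  have h1 := (hg.posDef_one_sub_box hκ F A B).det_pos
  have hs := ((hg.hasSum_box_loops hκ F A B).sub (hg.hasSum_box_loops hκ F ∅ ∅)).mul_left (1 / 2)
  have hcongr : ∀ γ : Loop, (1 / 2 : ℝ) *
      (if ∀ v ∈ γ.2.1.support, v ∈ Set.range (site ϑ h F) then (massiveLoopMass κ γ : ℝ)
        * (realSign (loopSign (A.disjSum B) (Sum.elim id θ) γ) - 1) else 0)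
      = 1 / 2 * ((if ∀ v ∈ γ.2.1.support, v ∈ Set.range (site ϑ h F) then
        (massiveLoopMass κ γ : ℝ) * realSign (loopSign (A.disjSum B) (Sum.elim id θ) γ) else 0)
        - if ∀ v ∈ γ.2.1.support, v ∈ Set.range (site ϑ h F) then
        (massiveLoopMass κ γ : ℝ) * realSign (loopSign ((∅ : Finset Face).disjSum ∅)
          (Sum.elim id θ) γ) else 0) := by
    intro γ
    have : loopSign ((∅ : Finset Face).disjSum ∅) (Sum.elim id θ) γ = 1 := by simp [loopSign]
    rw [this, map_one]
    split_ifs <;> ring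
  rw [tsum_congr hcongr, hs.tsum_eq, ← Real.exp_log (Real.sqrt_pos.2 h0),
    ← Real.exp_log (Real.sqrt_pos.2 h1), ← Real.exp_neg, ← Real.exp_add,
    Real.log_sqrt h0.le, Real.log_sqrt h1.le]
  congr 1; ring

/-- The correlations in infinite volume are the limits of those in finite boxes, by dominated
convergence in the exponent. -/
theorem tendsto_exp_box (hg : MirrorGeometry ϑ θ H d h) {κ : ℝ≥0} (hκ : 0 < κ)
    (A B : Finset Face) :
    Tendsto (fun F : Finset (ℤ × ℤ) =>
      √(1 - stepMatrix (site ϑ h F) (boxWeight ϑ h d κ F ∅ ∅)).det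
        * (√(1 - stepMatrix (site ϑ h F) (boxWeight ϑ h d κ F A B)).det)⁻¹) atTop
      (𝓝 (∫ ω, (∏ z ∈ A, realSign (spinField ω z)) * ∏ z ∈ B, realSign (spinField ω (θ z))
        ∂loopSoup κ (1 / 2))) := by
  classical
  have hint := integral_prod_spinField hκ (1 / 2) (A.disjSum B) (Sum.elim id θ)
  simp only [Finset.prod_disjSum, Sum.elim_inl, Sum.elim_inr, id] at hint
  rw [hint]
  simp_rw [← hg.exp_box_eq hκ _ A B]
  refine (Real.continuous_exp.tendsto _).comp ?_
  have hsum := ((summable_mass_mul_loopSign hκ (A.disjSum B) (Sum.elim id θ)).mul_left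
    (1 / 2 : ℝ)).norm
  refine tendsto_tsum_of_dominated_convergence hsum (fun γ => ?_)
    (Eventually.of_forall fun F γ => ?_)
  · refine tendsto_const_nhds.congr' ?_
    filter_upwards [eventually_ge_atTop
      (γ.2.1.support.toFinset ∪ γ.2.1.support.toFinset.image ϑ)] with F hF
    rw [if_pos]
    · simp
    · intro v hv
      refine hg.mem_range_site (hF ?_) (hF ?_)
      · exact Finset.mem_union_left _ (List.mem_toFinset.2 hv)
      · exact Finset.mem_union_right _ (Finset.mem_image_of_mem _ (List.mem_toFinset.2 hv))
  · split_ifs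
    · exact le_rfl
    · rw [mul_zero, norm_zero]; positivity

/-- Reflection positivity of the correlations: they are limits of Gaussian partition functions. -/
theorem sum_correlation_nonneg (hg : MirrorGeometry ϑ θ H d h) {κ : ℝ≥0} (hκ : 0 < κ)
    {ι : Type*} (s : Finset ι) (c : ι → ℝ) (A : ι → Finset Face) (hA : ∀ i ∈ s, ↑(A i) ⊆ H) :
    0 ≤ ∑ i ∈ s, ∑ j ∈ s, c i * c j *
      ∫ ω, (∏ z ∈ A i, realSign (spinField ω z)) * ∏ z ∈ A j, realSign (spinField ω (θ z))
        ∂loopSoup κ (1 / 2) := by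
  classical
  refine ge_of_tendsto' (x := atTop) (tendsto_finsetSum s fun i _ => tendsto_finsetSum s fun j _ =>
    (hg.tendsto_exp_box hκ (A i) (A j)).const_mul (c i * c j)) fun F => ?_
  have hM := fun i hi j hj => hg.one_sub_stepMatrix_eq_mirrorBlock κ F (hA i hi) (hA j hj)
  have h1 := sum_mul_inv_sqrt_det_mirrorBlock_nonneg s c
    (k := mirrorCoupling ϑ h κ F)
    (fun x => by
      unfold mirrorCoupling edgeWeight
      rw [map_one]
      positivity) (fun i => sideBlock h d κ F (A i)) (fun i => lineBlock h d κ F (A i))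
    (fun i hi j hj => by
      rw [← hM i hi j hj]
      exact hg.posDef_one_sub_box hκ F (A i) (A j))
  have h2 := mul_nonneg
    (Real.sqrt_nonneg (1 - stepMatrix (site ϑ h F) (boxWeight ϑ h d κ F ∅ ∅)).det) h1
  rw [Finset.mul_sum] at h2
  refine h2.trans_eq (Finset.sum_congr rfl fun i hi => ?_)
  rw [Finset.mul_sum]
  refine Finset.sum_congr rfl fun j hj => ?_
  rw [hM i hi j hj]
  ring

end MirrorGeometry

end LoopSoup

/-! ### From correlations to functions of the spins -/

namespace LoopSoup

open Filter Topology
open scoped ENNReal BoundedContinuousFunction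

instance : BorelSpace ℤˣ := ⟨by
  rw [borel_eq_top_of_discrete]
  exact MeasurableSpace.ext fun s => ⟨fun _ => trivial, fun _ => .of_discrete⟩⟩

section Spins

variable {T : Type*}

/-- The product of the spins in `A`. -/
noncomputable def spinProd (A : Finset T) (x : T → ℤˣ) : ℝ := ∏ z ∈ A, realSign (x z)

open Classical in
/-- The configuration `x` with the spins outside of `S` set to `1`. -/
noncomputable def padSpins (S : Finset T) (x : T → ℤˣ) : T → ℤˣ := fun z => if z ∈ S then x z else 1

/-- A function of finitely many spins is a linear combination of products of spins. -/
theorem exists_eq_sum_spinProd (S : Finset T) (f : (T → ℤˣ) → ℝ) :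
    ∃ c : Finset T → ℝ, ∀ x, f (padSpins S x) = ∑ A ∈ S.powerset, c A * spinProd A x := by
  classical
  induction S using Finset.induction_on generalizing f with
  | empty => exact ⟨fun _ => f 1, fun x => by
      have : padSpins ∅ x = 1 := funext fun z => if_neg (Finset.notMem_empty z)
      simp [spinProd, this]⟩
  | insert a S ha ih =>
    obtain ⟨c₁, h₁⟩ := ih fun y => f (Function.update y a 1)
    obtain ⟨c₂, h₂⟩ := ih fun y => f (Function.update y a (-1))
    refine ⟨fun A => if a ∈ A then (c₁ (A.erase a) - c₂ (A.erase a)) / 2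
      else (c₁ A + c₂ A) / 2, fun x => ?_⟩
    have hup : f (padSpins (insert a S) x) = f (Function.update (padSpins S x) a (x a)) := by
      congr 1
      ext z : 1
      by_cases hz : z = a
      · subst hz; simp [padSpins]
      · simp [padSpins, hz]
    have hsplit : f (Function.update (padSpins S x) a (x a))
        = (1 + realSign (x a)) / 2 * f (Function.update (padSpins S x) a 1)
          + (1 - realSign (x a)) / 2 * f (Function.update (padSpins S x) a (-1)) := by
      rcases Int.units_eq_one_or (x a) with h | h <;> rw [h] <;> simp
    rw [hup, hsplit, h₁, h₂, Finset.sum_powerset_insert ha, Finset.mul_sum, Finset.mul_sum,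
      ← Finset.sum_add_distrib, ← Finset.sum_add_distrib]
    refine Finset.sum_congr rfl fun A hA => ?_
    have haA : a ∉ A := fun h => ha (Finset.mem_powerset.1 hA h)
    dsimp only
    rw [if_neg haA, if_pos (Finset.mem_insert_self a A), Finset.erase_insert haA]
    simp only [spinProd, Finset.prod_insert haA]
    ring

theorem tendsto_padSpins (x : T → ℤˣ) :
    Tendsto (fun S => padSpins S x) atTop (𝓝 x) := by
  rw [tendsto_pi_nhds]
  intro z
  refine tendsto_const_nhds.congr' ?_
  filter_upwards [eventually_ge_atTop {z}] with S hS
  exact (if_pos (hS (Finset.mem_singleton_self z))).symm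

theorem measurable_spinProd (A : Finset T) : Measurable (spinProd A) :=
  Finset.measurable_prod A fun z _ =>
    (Measurable.of_discrete (f := realSign)).comp (measurable_pi_apply z)

theorem abs_spinProd (A : Finset T) (x : T → ℤˣ) : |spinProd A x| = 1 := by
  simp [spinProd, Finset.abs_prod, abs_realSign]

theorem measurable_padSpins (S : Finset T) : Measurable (padSpins S) := by
  classical
  refine measurable_pi_lambda _ fun z => ?_
  by_cases hz : z ∈ S
  · simpa only [padSpins, if_pos hz] using measurable_pi_apply z
  · simpa only [padSpins, if_neg hz] using measurable_const

variable {Ω : Type*} [MeasurableSpace Ω] {P : Measure Ω} [IsProbabilityMeasure P]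
  {X Y : Ω → T → ℤˣ}

/-- Positivity for functions of finitely many spins, which are combinations of products of spins. -/
theorem integral_pad_mul_nonneg (hX : Measurable X) (hY : Measurable Y)
    (hpos : ∀ (s : Finset (Finset T)) (c : Finset T → ℝ),
      0 ≤ ∑ A ∈ s, ∑ B ∈ s, c A * c B * ∫ ω, spinProd A (X ω) * spinProd B (Y ω) ∂P)
    (S : Finset T) (f : (T → ℤˣ) → ℝ) :
    0 ≤ ∫ ω, f (padSpins S (X ω)) * f (padSpins S (Y ω)) ∂P := by
  obtain ⟨c, hc⟩ := exists_eq_sum_spinProd S f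
  refine (hpos S.powerset c).trans_eq ?_
  have hint : ∀ A B : Finset T, Integrable (fun ω => c A * c B *
      (spinProd A (X ω) * spinProd B (Y ω))) P := fun A B => by
    refine Integrable.const_mul (Integrable.of_bound (C := 1) ?_ (ae_of_all _ fun ω => ?_)) _
    · exact (((measurable_spinProd A).comp hX).mul
        ((measurable_spinProd B).comp hY)).aestronglyMeasurable
    · rw [norm_mul, Real.norm_eq_abs, Real.norm_eq_abs, abs_spinProd, abs_spinProd, one_mul]
  have hexp : ∀ ω, f (padSpins S (X ω)) * f (padSpins S (Y ω))
      = ∑ A ∈ S.powerset, ∑ B ∈ S.powerset, c A * c B *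
        (spinProd A (X ω) * spinProd B (Y ω)) := by
    intro ω
    rw [hc, hc, Finset.sum_mul_sum]
    refine Finset.sum_congr rfl fun A _ => Finset.sum_congr rfl fun B _ => ?_
    ring
  simp_rw [hexp]
  rw [integral_finsetSum _ fun A _ => integrable_finsetSum _ fun B _ => hint A B]
  refine Finset.sum_congr rfl fun A _ => ?_
  rw [integral_finsetSum _ fun B _ => hint A B]
  refine Finset.sum_congr rfl fun B _ => ?_
  rw [integral_const_mul]

variable [Countable T]

/-- Positivity for continuous functions, which are limits of functions of finitely many spins. -/
theorem integral_boundedContinuous_mul_nonneg (hX : Measurable X) (hY : Measurable Y)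
    (hpos : ∀ (s : Finset (Finset T)) (c : Finset T → ℝ),
      0 ≤ ∑ A ∈ s, ∑ B ∈ s, c A * c B * ∫ ω, spinProd A (X ω) * spinProd B (Y ω) ∂P)
    (f : (T → ℤˣ) →ᵇ ℝ) : 0 ≤ ∫ ω, f (X ω) * f (Y ω) ∂P := by
  have hf : Measurable f := f.continuous.measurable
  refine ge_of_tendsto' (x := atTop)
    (tendsto_integral_filter_of_dominated_convergence (fun _ => ‖f‖ * ‖f‖)
      (Eventually.of_forall fun S => ?_) (Eventually.of_forall fun S => ae_of_all _ fun ω => ?_)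
      (integrable_const _) (ae_of_all _ fun ω => ?_))
    fun S => integral_pad_mul_nonneg hX hY hpos S f
  · exact ((hf.comp ((measurable_padSpins S).comp hX)).mul
      (hf.comp ((measurable_padSpins S).comp hY))).aestronglyMeasurable
  · rw [norm_mul]
    exact mul_le_mul (f.norm_coe_le_norm _) (f.norm_coe_le_norm _) (norm_nonneg _) (norm_nonneg _)
  · exact ((f.continuous.tendsto _).comp (tendsto_padSpins _)).mul
      ((f.continuous.tendsto _).comp (tendsto_padSpins _))

/-- Positivity for square integrable functions, by density of the continuous functions. -/
theorem integral_memLp_mul_nonneg (hX : Measurable X) (hY : Measurable Y)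
    (hXY : P.map Y = P.map X)
    (hpos : ∀ (s : Finset (Finset T)) (c : Finset T → ℝ),
      0 ≤ ∑ A ∈ s, ∑ B ∈ s, c A * c B * ∫ ω, spinProd A (X ω) * spinProd B (Y ω) ∂P)
    {f : (T → ℤˣ) → ℝ} (hf : MemLp f 2 (P.map X)) : 0 ≤ ∫ ω, f (X ω) * f (Y ω) ∂P := by
  have : IsProbabilityMeasure (P.map X) := Measure.isProbabilityMeasure_map hX.aemeasurable
  have mX : MeasurePreserving X P (P.map X) := ⟨hX, rfl⟩
  have mY : MeasurePreserving Y P (P.map X) := ⟨hY, hXY⟩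
  have hval : ∀ (u : Lp ℝ 2 (P.map X)) (g : (T → ℤˣ) → ℝ), u =ᵐ[P.map X] g →
      inner ℝ (Lp.compMeasurePreserving X mX u) (Lp.compMeasurePreserving Y mY u)
        = ∫ ω, g (X ω) * g (Y ω) ∂P := by
    intro u g hug
    rw [L2.inner_def]
    refine integral_congr_ae ?_
    filter_upwards [Lp.coeFn_compMeasurePreserving u mX, Lp.coeFn_compMeasurePreserving u mY,
      mX.quasiMeasurePreserving.ae_eq_comp hug, mY.quasiMeasurePreserving.ae_eq_comp hug]
      with ω h1 h2 h3 h4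
    rw [h1, h2, h3, h4, Function.comp_apply, Function.comp_apply, real_inner_eq_re_inner]
    simp [mul_comm]
  have key : ∀ u : Lp ℝ 2 (P.map X),
      0 ≤ inner ℝ (Lp.compMeasurePreserving X mX u) (Lp.compMeasurePreserving Y mY u) := by
    intro u
    refine (BoundedContinuousFunction.toLp_denseRange ℝ (P.map X) (p := 2) ℝ
      ENNReal.ofNat_ne_top).induction_on u ?_ fun g => ?_
    · refine isClosed_le continuous_const (Continuous.inner ?_ ?_)
      · exact (Lp.compMeasurePreservingₗᵢ ℝ X mX).continuous
      · exact (Lp.compMeasurePreservingₗᵢ ℝ Y mY).continuous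
    · rw [hval _ g (BoundedContinuousFunction.coeFn_toLp 2 (P.map X) ℝ g)]
      exact integral_boundedContinuous_mul_nonneg hX hY hpos g
  rw [← hval (hf.toLp f) f hf.coeFn_toLp]
  exact key _

/-- Positivity for all measurable functions for which the expectation exists, by truncation. -/
theorem integral_mul_nonneg_of_spinProd (hX : Measurable X) (hY : Measurable Y)
    (hXY : P.map Y = P.map X)
    (hpos : ∀ (s : Finset (Finset T)) (c : Finset T → ℝ),
      0 ≤ ∑ A ∈ s, ∑ B ∈ s, c A * c B * ∫ ω, spinProd A (X ω) * spinProd B (Y ω) ∂P)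
    {f : (T → ℤˣ) → ℝ} (hf : Measurable f) (hint : Integrable (fun ω => f (X ω) * f (Y ω)) P) :
    0 ≤ ∫ ω, f (X ω) * f (Y ω) ∂P := by
  have : IsProbabilityMeasure (P.map X) := Measure.isProbabilityMeasure_map hX.aemeasurable
  set g : ℕ → (T → ℤˣ) → ℝ := fun n => {x | |f x| ≤ n}.indicator f with hg
  have hgm : ∀ n, Measurable (g n) := fun n =>
    hf.indicator (measurableSet_le hf.abs measurable_const)
  have hgle : ∀ n x, |g n x| ≤ |f x| := fun n x => by
    rw [hg]
    exact norm_indicator_le_norm_self f x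
  have hgn : ∀ (n : ℕ) x, |g n x| ≤ n := fun n x => by
    rw [hg]
    by_cases hx : |f x| ≤ n
    · simpa only [Set.indicator_of_mem (show x ∈ {x | |f x| ≤ n} from hx)] using hx
    · simp only [Set.indicator_of_notMem (show x ∉ {x | |f x| ≤ n} from hx), abs_zero]
      positivity
  have hlim : ∀ x, Tendsto (fun n => g n x) atTop (𝓝 (f x)) := fun x => by
    refine tendsto_const_nhds.congr' ?_
    filter_upwards [eventually_ge_atTop ⌈|f x|⌉₊] with n hn
    exact (Set.indicator_of_mem (show x ∈ {x | |f x| ≤ n} from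
      (Nat.le_ceil |f x|).trans (Nat.cast_le.2 hn)) f).symm
  refine ge_of_tendsto' (x := atTop)
    (tendsto_integral_of_dominated_convergence (F := fun n ω => g n (X ω) * g n (Y ω))
      (fun ω => ‖f (X ω) * f (Y ω)‖)
      (fun n => (((hgm n).comp hX).mul ((hgm n).comp hY)).aestronglyMeasurable)
      hint.norm (fun n => ae_of_all _ fun ω => ?_)
      (ae_of_all _ fun ω => (hlim (X ω)).mul (hlim (Y ω))))
    fun n => integral_memLp_mul_nonneg hX hY hXY hpos (f := g n) ?_
  · rw [norm_mul, norm_mul]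
    exact mul_le_mul (hgle n _) (hgle n _) (norm_nonneg _) (norm_nonneg _)
  · exact MemLp.of_bound (hgm n).aestronglyMeasurable n (ae_of_all _ fun x => hgn n x)

end Spins

/-- Reflection positivity of the spin field, for the reflections with a mirror geometry. The
symmetry holds since the law of the soup is invariant under reflection. -/
theorem MirrorGeometry.isReflectionPositive {ϑ : ℤ × ℤ → ℤ × ℤ} {θ : Face → Face} {H : Set Face}
    {d : ℤ × ℤ} {h : ℤ × ℤ → ℤ} (hg : MirrorGeometry ϑ θ H d h) {κ : ℝ≥0} (hκ : 0 < κ) :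
    IsReflectionPositive (loopSoup κ (1 / 2)) spinField H θ := by
  have hmp := hg.measurePreserving_soupEquiv κ (1 / 2)
  have hX : Measurable fun ω => restrictSpins H (spinField ω) :=
    measurable_pi_lambda _ fun z => measurable_spinField _
  have hY : Measurable fun ω => restrictSpins H (spinField ω ∘ θ) :=
    measurable_pi_lambda _ fun z => measurable_spinField _
  have hXY : ∀ ω, restrictSpins H (spinField (hg.soupEquiv ω))
      = restrictSpins H (spinField ω ∘ θ) := fun ω => by rw [hg.spinField_soupEquiv]
  have hYX : ∀ ω, restrictSpins H (spinField (hg.soupEquiv ω) ∘ θ)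
      = restrictSpins H (spinField ω) := fun ω => by
    rw [hg.spinField_soupEquiv, Function.comp_assoc, hg.face_involutive.comp_self,
      Function.comp_id]
  constructor
  · intro f g hf hgm hint
    have hcomp : (fun ω => f (restrictSpins H (spinField ω)) *
          g (restrictSpins H (spinField ω ∘ θ))) ∘ hg.soupEquiv
        = fun ω => g (restrictSpins H (spinField ω)) *
          f (restrictSpins H (spinField ω ∘ θ)) := by
      ext ω
      rw [Function.comp_apply, hXY, hYX, mul_comm]
    have hm : Measurable fun ω => f (restrictSpins H (spinField ω)) *
        g (restrictSpins H (spinField ω ∘ θ)) := (hf.comp hX).mul (hgm.comp hY)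
    refine ⟨hcomp ▸ hmp.integrable_comp_of_integrable hint, ?_⟩
    rw [← hcomp]
    conv_lhs => rw [← hmp.map_eq]
    exact integral_map hmp.measurable.aemeasurable hm.aestronglyMeasurable
  · intro f hf hint
    refine integral_mul_nonneg_of_spinProd hX hY ?_ ?_ hf hint
    · have h1 : (fun ω => restrictSpins H (spinField ω ∘ θ))
          = (fun ω => restrictSpins H (spinField ω)) ∘ hg.soupEquiv :=
        funext fun ω => (hXY ω).symm
      rw [h1, ← Measure.map_map hX hmp.measurable, hmp.map_eq]
    · intro s c
      have h1 := hg.sum_correlation_nonneg hκ s c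
        (fun A => A.map (Function.Embedding.subtype (· ∈ H))) (fun A _ z hz => by
          obtain ⟨w, -, rfl⟩ := Finset.mem_map.1 (Finset.mem_coe.1 hz)
          exact w.2)
      simpa only [Finset.prod_map, Function.Embedding.subtype_apply] using! h1

end LoopSoup

/-! ### The lines of reflection -/

namespace LoopSoup

theorem adj_of_cases {x y : ℤ × ℤ} (h : (y.1 = x.1 + 1 ∧ y.2 = x.2) ∨ (y.1 = x.1 - 1 ∧ y.2 = x.2) ∨
    (y.1 = x.1 ∧ y.2 = x.2 + 1) ∨ (y.1 = x.1 ∧ y.2 = x.2 - 1)) : squareLattice.Adj x y := by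
  change |x.1 - y.1| + |x.2 - y.2| = 1
  rcases abs_cases (x.1 - y.1) with h1 | h1 <;> rcases abs_cases (x.2 - y.2) with h2 | h2 <;> omega

/-- `α` is a primitive integer normal vector of a horizontal, vertical or diagonal line, and
`k = 2 / |α|²` is the factor in the formula for the reflection in that line. -/
def IsNormal (α : ℤ × ℤ) (k : ℤ) : Prop :=
  ((α = (1, 0) ∨ α = (-1, 0) ∨ α = (0, 1) ∨ α = (0, -1)) ∧ k = 2) ∨
  ((α = (1, 1) ∨ α = (1, -1) ∨ α = (-1, 1) ∨ α = (-1, -1)) ∧ k = 1)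

/-- A lattice direction that points into the half-plane towards which `α` points. For a diagonal
line either component of `α` would do. -/
def inwardDirection (α : ℤ × ℤ) : ℤ × ℤ := if α.1 = 0 then (0, α.2) else (α.1, 0)

/-- The rescaled signed distance of a vertex to the line through the centre of `z₀` with
normal `α`, i.e. twice its inner product with `α`, which is an integer. -/
def height (z₀ : Face) (α : ℤ × ℤ) (v : ℤ × ℤ) : ℤ :=
  α.1 * (2 * v.1 - 2 * z₀.1 - 1) + α.2 * (2 * v.2 - 2 * z₀.2 - 1)

section Normal

variable {z₀ : Face} {α : ℤ × ℤ} {k : ℤ}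

theorem reflect_vertex_involutive (hα : IsNormal α k) {ϑ : ℤ × ℤ → ℤ × ℤ}
    (hϑ : ∀ v, 2 * (ϑ v).1 = 2 * v.1 - k * α.1 * height z₀ α v ∧
      2 * (ϑ v).2 = 2 * v.2 - k * α.2 * height z₀ α v) (v : ℤ × ℤ) : ϑ (ϑ v) = v := by
  have h1 := hϑ v
  have h2 := hϑ (ϑ v)
  unfold height at h1 h2
  rcases hα with ⟨rfl | rfl | rfl | rfl, rfl⟩ | ⟨rfl | rfl | rfl | rfl, rfl⟩ <;>
    dsimp only at h1 h2 <;> ext <;> omega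

theorem reflect_face_involutive (hα : IsNormal α k) {θ : Face → Face}
    (hθ : ∀ z, (θ z).1 = z.1 - k * α.1 * (α.1 * (z.1 - z₀.1) + α.2 * (z.2 - z₀.2)) ∧
      (θ z).2 = z.2 - k * α.2 * (α.1 * (z.1 - z₀.1) + α.2 * (z.2 - z₀.2))) (z : Face) :
    θ (θ z) = z := by
  have h1 := hθ z
  have h2 := hθ (θ z)
  rcases hα with ⟨rfl | rfl | rfl | rfl, rfl⟩ | ⟨rfl | rfl | rfl | rfl, rfl⟩ <;>
    dsimp only at h1 h2 <;> ext <;> omega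

theorem adj_reflect (hα : IsNormal α k) {ϑ : ℤ × ℤ → ℤ × ℤ}
    (hϑ : ∀ v, 2 * (ϑ v).1 = 2 * v.1 - k * α.1 * height z₀ α v ∧
      2 * (ϑ v).2 = 2 * v.2 - k * α.2 * height z₀ α v) {x y : ℤ × ℤ}
    (hxy : squareLattice.Adj x y) : squareLattice.Adj (ϑ x) (ϑ y) := by
  have h1 := hϑ x
  have h2 := hϑ y
  unfold height at h1 h2
  apply adj_of_cases
  rcases adj_cases hxy with h3 | h3 | h3 | h3 <;> obtain ⟨h3, h4⟩ := h3 <;>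
    rw [h3, h4] at h2 <;> clear h3 h4 <;>
    rcases hα with ⟨rfl | rfl | rfl | rfl, rfl⟩ | ⟨rfl | rfl | rfl | rfl, rfl⟩ <;>
    dsimp only at h1 h2 <;> omega

theorem isDirection_inwardDirection (hα : IsNormal α k) : IsDirection (inwardDirection α) := by
  unfold IsDirection
  rcases hα with ⟨rfl | rfl | rfl | rfl, rfl⟩ | ⟨rfl | rfl | rfl | rfl, rfl⟩ <;> decide

theorem height_reflect_of_isNormal (hα : IsNormal α k) {ϑ : ℤ × ℤ → ℤ × ℤ}
    (hϑ : ∀ v, 2 * (ϑ v).1 = 2 * v.1 - k * α.1 * height z₀ α v ∧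
      2 * (ϑ v).2 = 2 * v.2 - k * α.2 * height z₀ α v) (v : ℤ × ℤ) :
    height z₀ α (ϑ v) = -height z₀ α v := by
  have h1 := hϑ v
  unfold height at h1 ⊢
  rcases hα with ⟨rfl | rfl | rfl | rfl, rfl⟩ | ⟨rfl | rfl | rfl | rfl, rfl⟩ <;>
    dsimp only at h1 ⊢ <;> omega

set_option maxHeartbeats 1000000 in
/-- Rays in the inward direction that start in the closed half-plane stay in it. -/
theorem height_nonneg_of_crossesRay (hα : IsNormal α k) {z : Face}
    (hz : 0 ≤ α.1 * (z.1 - z₀.1) + α.2 * (z.2 - z₀.2)) {x y : ℤ × ℤ}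
    (hxy : squareLattice.Adj x y) (hc : CrossesRay (inwardDirection α) z x y) :
    0 ≤ height z₀ α x ∧ 0 ≤ height z₀ α y := by
  obtain ⟨hx, hy, hs⟩ := hc
  have hs' := mul_neg_iff.1 hs
  clear hs
  unfold along inwardDirection at hx hy
  unfold across inwardDirection at hs'
  unfold height
  have h3 := adj_cases hxy
  rcases hα with ⟨rfl | rfl | rfl | rfl, rfl⟩ | ⟨rfl | rfl | rfl | rfl, rfl⟩ <;>
    norm_num at hz hx hy hs' ⊢ <;> rcases hs' with hs' | hs' <;> omega

theorem height_ne_zero_of_adj_of_isNormal (hα : IsNormal α k) {x y : ℤ × ℤ}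
    (hxy : squareLattice.Adj x y) (hx : height z₀ α x = 0) : height z₀ α y ≠ 0 := by
  have h3 := adj_cases hxy
  unfold height at hx ⊢
  rcases hα with ⟨rfl | rfl | rfl | rfl, rfl⟩ | ⟨rfl | rfl | rfl | rfl, rfl⟩ <;>
    dsimp only at hx ⊢ <;> omega

/-- An edge that crosses the line is orthogonal to it: this happens only for horizontal and vertical
lines, since a diagonal line through a face centre meets the edges in vertices only. -/
theorem eq_reflect_of_adj_of_isNormal (hα : IsNormal α k) {ϑ : ℤ × ℤ → ℤ × ℤ}
    (hϑ : ∀ v, 2 * (ϑ v).1 = 2 * v.1 - k * α.1 * height z₀ α v ∧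
      2 * (ϑ v).2 = 2 * v.2 - k * α.2 * height z₀ α v) {x y : ℤ × ℤ}
    (hxy : squareLattice.Adj x y) (hx : 0 < height z₀ α x) (hy : height z₀ α y < 0) :
    y = ϑ x := by
  have h1 := hϑ x
  unfold height at hx hy h1
  rcases adj_cases hxy with h3 | h3 | h3 | h3 <;>
    rcases hα with ⟨rfl | rfl | rfl | rfl, rfl⟩ | ⟨rfl | rfl | rfl | rfl, rfl⟩ <;>
    dsimp only at hx hy h1 <;> first | omega | (ext <;> omega)

/-- The hypotheses are the formulas for the reflection in integer coordinates. -/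
theorem mirrorGeometry_of_isNormal (hα : IsNormal α k)
    {ϑ : ℤ × ℤ → ℤ × ℤ} {θ : Face → Face}
    (hϑ : ∀ v, 2 * (ϑ v).1 = 2 * v.1 - k * α.1 * height z₀ α v ∧
      2 * (ϑ v).2 = 2 * v.2 - k * α.2 * height z₀ α v)
    (hθ : ∀ z, (θ z).1 = z.1 - k * α.1 * (α.1 * (z.1 - z₀.1) + α.2 * (z.2 - z₀.2)) ∧
      (θ z).2 = z.2 - k * α.2 * (α.1 * (z.1 - z₀.1) + α.2 * (z.2 - z₀.2)))
    (hconj : ∃ η : ℂ, η ≠ 0 ∧ ∀ v z,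
      vertexPoint (ϑ v) - faceCenter (θ z) = η * (starRingEnd ℂ) (vertexPoint v - faceCenter z)) :
    MirrorGeometry ϑ θ {z | 0 ≤ α.1 * (z.1 - z₀.1) + α.2 * (z.2 - z₀.2)} (inwardDirection α)
      (height z₀ α) where
  vertex_involutive := reflect_vertex_involutive hα hϑ
  face_involutive := reflect_face_involutive hα hθ
  adj _ _ hxy := adj_reflect hα hϑ hxy
  conj := hconj
  isDirection := isDirection_inwardDirection hα
  height_reflect := height_reflect_of_isNormal hα hϑ
  reflect_of_height_eq_zero v hv := by
    have h1 := hϑ v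
    rw [hv] at h1
    ext <;> omega
  nonneg_of_crossesRay _ hz _ _ hxy hc := height_nonneg_of_crossesRay hα hz hxy hc
  height_ne_zero_of_adj _ _ hxy hx := height_ne_zero_of_adj_of_isNormal hα hxy hx
  eq_reflect_of_adj _ _ hxy hx hy := eq_reflect_of_adj_of_isNormal hα hϑ hxy hx hy

end Normal

theorem inner_eq (u w : ℂ) : inner ℝ u w = u.re * w.re + u.im * w.im := by
  rw [Complex.inner]
  simp [Complex.mul_re]
  ring

/-- A line through a face centre in which the reflection preserves the lattice is horizontal,
vertical or diagonal. -/
theorem exists_isNormal {c u : ℂ} (hu : ‖u‖ = 1)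
    (h : ∀ v : ℤ × ℤ, ∃ v' : ℤ × ℤ, reflectPoint c u (vertexPoint v) = vertexPoint v') :
    ∃ (α : ℤ × ℤ) (k : ℤ) (s : ℝ), IsNormal α k ∧ 0 < s ∧ u.re = s * α.1 ∧ u.im = s * α.2 ∧
      2 * s ^ 2 = k := by
  have hn : u.re ^ 2 + u.im ^ 2 = 1 := by
    have h1 := Complex.sq_norm u
    rw [hu, Complex.normSq_apply] at h1
    linarith
  obtain ⟨p, hp⟩ := h (0, 0)
  obtain ⟨q, hq⟩ := h (1, 0)
  have hp1 := congrArg Complex.re hp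
  have hq1 := congrArg Complex.re hq
  simp only [reflectPoint, inner_eq, vertexPoint, Complex.sub_re, Complex.sub_im, Complex.mul_re,
    Complex.ofReal_re, Complex.ofReal_im, zero_mul, sub_zero, Int.cast_zero, Int.cast_one]
    at hp1 hq1
  -- the images of two neighbouring vertices differ by a lattice vector, so `2 * u.re ^ 2` is an
  -- integer, and it lies in `[0, 2]`
  have h2 : 2 * u.re ^ 2 = ((p.1 - q.1 + 1 : ℤ) : ℝ) := by
    push_cast
    linear_combination hp1 - hq1
  obtain ⟨m, hm⟩ : ∃ m : ℤ, 2 * u.re ^ 2 = m := ⟨_, h2⟩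
  have hm0 : 0 ≤ m := by
    have : (0 : ℝ) ≤ m := by rw [← hm]; positivity
    exact_mod_cast this
  have hm2 : m ≤ 2 := by
    have : (m : ℝ) ≤ 2 := by rw [← hm]; nlinarith [sq_nonneg u.im]
    exact_mod_cast this
  have hcase : m = 0 ∨ m = 1 ∨ m = 2 := by omega
  have hsq : √(1 / 2 : ℝ) ^ 2 = 1 / 2 := Real.sq_sqrt (by norm_num)
  have hs : 0 < √(1 / 2 : ℝ) := Real.sqrt_pos.2 (by norm_num)
  rcases hcase with rfl | rfl | rfl
  · have ha : u.re = 0 := by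
      rw [Int.cast_zero] at hm
      exact pow_eq_zero_iff two_ne_zero |>.1 (by linarith)
    have hb : u.im = 1 ∨ u.im = -1 := sq_eq_one_iff.1 (by rw [ha] at hn; linarith)
    rcases hb with hb | hb
    · exact ⟨(0, 1), 2, 1, by simp [IsNormal], one_pos, by simp [ha], by simp [hb], by norm_num⟩
    · exact ⟨(0, -1), 2, 1, by simp [IsNormal], one_pos, by simp [ha], by simp [hb], by norm_num⟩
  · have ha : u.re = √(1 / 2) ∨ u.re = -√(1 / 2) :=
      sq_eq_sq_iff_eq_or_eq_neg.1 (by rw [hsq]; push_cast at hm; linarith)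
    have hb : u.im = √(1 / 2) ∨ u.im = -√(1 / 2) :=
      sq_eq_sq_iff_eq_or_eq_neg.1 (by rw [hsq]; push_cast at hm; linarith)
    rcases ha with ha | ha <;> rcases hb with hb | hb
    · exact ⟨(1, 1), 1, _, by simp [IsNormal], hs, by simp [ha], by simp [hb], by rw [hsq]; norm_num⟩
    · exact ⟨(1, -1), 1, _, by simp [IsNormal], hs, by simp [ha], by simp [hb],
        by rw [hsq]; norm_num⟩
    · exact ⟨(-1, 1), 1, _, by simp [IsNormal], hs, by simp [ha], by simp [hb],
        by rw [hsq]; norm_num⟩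
    · exact ⟨(-1, -1), 1, _, by simp [IsNormal], hs, by simp [ha], by simp [hb],
        by rw [hsq]; norm_num⟩
  · have hb : u.im = 0 := by
      push_cast at hm
      exact pow_eq_zero_iff two_ne_zero |>.1 (by linarith)
    have ha : u.re = 1 ∨ u.re = -1 := sq_eq_one_iff.1 (by rw [hb] at hn; linarith)
    rcases ha with ha | ha
    · exact ⟨(1, 0), 2, 1, by simp [IsNormal], one_pos, by simp [ha], by simp [hb], by norm_num⟩
    · exact ⟨(-1, 0), 2, 1, by simp [IsNormal], one_pos, by simp [ha], by simp [hb], by norm_num⟩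

theorem reflectPoint_sub_reflectPoint {c u : ℂ} (hu : ‖u‖ = 1) (w w' : ℂ) :
    reflectPoint c u w - reflectPoint c u w' = -u ^ 2 * (starRingEnd ℂ) (w - w') := by
  have hn : u.re ^ 2 + u.im ^ 2 = 1 := by
    have h1 := Complex.sq_norm u
    rw [hu, Complex.normSq_apply] at h1
    linarith
  apply Complex.ext
  · simp only [reflectPoint, inner_eq, sq, Complex.sub_re, Complex.sub_im, Complex.mul_re,
      Complex.mul_im, Complex.neg_re, Complex.neg_im, Complex.ofReal_re, Complex.ofReal_im,
      Complex.conj_re, Complex.conj_im]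
    linear_combination -(w.re - w'.re) * hn
  · simp only [reflectPoint, inner_eq, sq, Complex.sub_re, Complex.sub_im, Complex.mul_re,
      Complex.mul_im, Complex.neg_re, Complex.neg_im, Complex.ofReal_re, Complex.ofReal_im,
      Complex.conj_re, Complex.conj_im]
    linear_combination -(w.im - w'.im) * hn

theorem exists_mirrorGeometry (z₀ : Face) {u : ℂ} (hu : ‖u‖ = 1)
    (h : ∀ v : ℤ × ℤ, ∃ v' : ℤ × ℤ,
      reflectPoint (faceCenter z₀) u (vertexPoint v) = vertexPoint v') :
    ∃ ϑ d ht,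
      MirrorGeometry ϑ (reflectFace (faceCenter z₀) u) (halfFaces (faceCenter z₀) u) d ht := by
  obtain ⟨α, k, s, hα, hs, hre, him, hk⟩ := exists_isNormal hu h
  choose ϑ hϑ using h
  have hface : ∀ z, reflectPoint (faceCenter z₀) u (faceCenter z) = faceCenter
      (z.1 - k * α.1 * (α.1 * (z.1 - z₀.1) + α.2 * (z.2 - z₀.2)),
       z.2 - k * α.2 * (α.1 * (z.1 - z₀.1) + α.2 * (z.2 - z₀.2))) := by
    intro z
    apply Complex.ext
    · simp only [reflectPoint, inner_eq, faceCenter, Complex.sub_re, Complex.sub_im,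
        Complex.mul_re, Complex.ofReal_re, Complex.ofReal_im, hre, him]
      push_cast
      rw [← hk]
      ring
    · simp only [reflectPoint, inner_eq, faceCenter, Complex.sub_re, Complex.sub_im,
        Complex.mul_im, Complex.ofReal_re, Complex.ofReal_im, hre, him]
      push_cast
      rw [← hk]
      ring
  have hfloor : ∀ z, faceAt (faceCenter z) = z := by
    intro z
    have h1 : ∀ n : ℤ, ⌊(n : ℝ) + 1 / 2⌋ = n := fun n => by
      rw [Int.floor_intCast_add]; norm_num
    simp only [faceAt, faceCenter, h1]
  have hθ : ∀ z, reflectFace (faceCenter z₀) u z =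
      (z.1 - k * α.1 * (α.1 * (z.1 - z₀.1) + α.2 * (z.2 - z₀.2)),
       z.2 - k * α.2 * (α.1 * (z.1 - z₀.1) + α.2 * (z.2 - z₀.2))) := fun z => by
    rw [reflectFace, hface, hfloor]
  have hhalf : halfFaces (faceCenter z₀) u
      = {z | 0 ≤ α.1 * (z.1 - z₀.1) + α.2 * (z.2 - z₀.2)} := by
    ext z
    have h1 : inner ℝ u (faceCenter z - faceCenter z₀)
        = s * ((α.1 * (z.1 - z₀.1) + α.2 * (z.2 - z₀.2) : ℤ) : ℝ) := by
      simp only [inner_eq, faceCenter, Complex.sub_re, Complex.sub_im, hre, him]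
      push_cast
      ring
    change 0 ≤ inner ℝ u (faceCenter z - faceCenter z₀) ↔ _
    rw [h1, mul_nonneg_iff_of_pos_left hs, Int.cast_nonneg_iff]
    rfl
  refine ⟨ϑ, inwardDirection α, height z₀ α, ?_⟩
  rw [hhalf]
  refine mirrorGeometry_of_isNormal hα (fun v => ?_) (fun z => by rw [hθ]; exact ⟨rfl, rfl⟩)
    ⟨-u ^ 2, ?_, fun v z => ?_⟩
  · have h1 := congrArg Complex.re (hϑ v)
    have h2 := congrArg Complex.im (hϑ v)
    simp only [reflectPoint, inner_eq, faceCenter, vertexPoint, Complex.sub_re, Complex.sub_im,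
      Complex.mul_re, Complex.mul_im, Complex.ofReal_re, Complex.ofReal_im, hre, him] at h1 h2
    constructor
    · have : (2 * (ϑ v).1 : ℝ) = 2 * v.1 - k * α.1 * (height z₀ α v : ℝ) := by
        rw [← h1, ← hk, height]
        push_cast
        ring
      exact_mod_cast this
    · have : (2 * (ϑ v).2 : ℝ) = 2 * v.2 - k * α.2 * (height z₀ α v : ℝ) := by
        rw [← h2, ← hk, height]
        push_cast
        ring
      exact_mod_cast this
  · have : u ≠ 0 := fun h0 => by rw [h0, norm_zero] at hu; exact zero_ne_one hu
    exact neg_ne_zero.2 (pow_ne_zero 2 this)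
  · rw [hθ, ← hface, ← hϑ, reflectPoint_sub_reflectPoint hu]

end LoopSoup

theorem mainTheorem6 (κ : ℝ≥0) (hκ : 0 < κ) :
    -- the spin field is well defined almost surely, and it is a random field
    (∀ᵐ ω ∂LoopSoup.loopSoup κ (1 / 2), ∀ z : LoopSoup.Face,
      {γ : LoopSoup.Loop | ω γ ≠ 0 ∧ LoopSoup.windingNumber γ z ≠ 0}.Finite) ∧
    (∀ z : LoopSoup.Face, Measurable fun ω => LoopSoup.spinField ω z) ∧
    -- reflection positivity in every lattice symmetric line through a dual vertex
    ∀ (z₀ : LoopSoup.Face) (u : ℂ), ‖u‖ = 1 →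
      (∀ v : ℤ × ℤ, ∃ v' : ℤ × ℤ,
        LoopSoup.reflectPoint (LoopSoup.faceCenter z₀) u (LoopSoup.vertexPoint v)
          = LoopSoup.vertexPoint v') →
      LoopSoup.IsReflectionPositive (LoopSoup.loopSoup κ (1 / 2)) LoopSoup.spinField
        (LoopSoup.halfFaces (LoopSoup.faceCenter z₀) u)
        (LoopSoup.reflectFace (LoopSoup.faceCenter z₀) u) := by
  refine ⟨LoopSoup.ae_finite_winding hκ _, LoopSoup.measurable_spinField, fun z₀ u hu h => ?_⟩
  obtain ⟨ϑ, d, ht, hg⟩ := LoopSoup.exists_mirrorGeometry z₀ hu h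
  exact hg.isReflectionPositive hκ
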